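/- Let $N,l\ge 1$ be integers and let $\varGamma$ be one of the congruence subgroups $\varGamma_0(N)$, $\varGamma_1(N)$, $\varGamma(N)$ of $SL(2,\mathbb Z)$. Let $\nu_2,\nu_3$ be the numbers of primitive elliptic classes of $\varGamma$ of order $2$ and $3$, i.e. of conjugacy classes of the cyclic groups generated by primitive elliptic elements of order $2$, $3$ in $\varGamma/(\varGamma\cap\{\pm1\})$. For $s\in\mathbb C$ put $h(r)=\phi_s(r)+\phi_s(-r)$, where $$\phi_s(r)=\sum_{m=0}^{\infty}\Big\{\frac{1}{(s+lm+l-\frac12+ir)^2}-\frac1l\,\frac{1}{s+lm+\frac l2-\frac12+ir}+\frac1l\,\frac{1}{s+lm+\frac{3l}2-\frac12+ir}\Big\}.$$ Let $\Gamma_2$ be the Barnes–Vignéras double gamma function, $$\frac1{\Gamma_2(z+1)}=\exp\Big\{\big(-\tfrac12-\tfrac\gamma2\big)z^2+\big(-\tfrac12-\zeta'(0)\big)z\Big\}\prod_{k=1}^\infty\Big(1+\frac zk\Big)^k\exp\Big(-z+\frac{z^2}{2k}\Big),$$ and put $$G_l(s)=\begin{cases}\exp\big(\frac{s}{2l}\log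 l\big)\prod_{r=0}^{l-1}\Gamma\big(\frac{s+l+r}{2l}\big)^{(-1)^r}& l\text{ odd},\\ \exp\big(\frac{s}{2l}\log\frac l2\big)\prod_{r=0}^{l-1}\Gamma_2\big(\frac{s+l+r}{l}\big)^{(-1)^r}& l\text{ even},\end{cases}$$ and, with empty products equal to $1$, $$H_l(s)=\exp\big(\tfrac{2s}{3l}\log l\big)\prod_{r=0}^{(l-1)/3}\Gamma\big(\tfrac{s+l+3r}{3l}\big)\Gamma\big(\tfrac{s+2l+3r}{3l}\big)\prod_{r=0}^{(l-4)/3}\Gamma\big(\tfrac{s+l+3r+2}{3l}\big)^{-1}\Gamma\big(\tfrac{s+2l+3r+1}{3l}\big)^{-1}\quad(l\equiv1\bmod 3),$$ $$H_l(s)=\exp\big(\tfrac{2s}{3l}\log l\big)\prod_{r=0}^{(l-2)/3}\Gamma\big(\tfrac{s+l+3r}{3l}\big)\Gamma\big(\tfrac{s+2l+3r+1}{3l}\big)\prod_{r=0}^{(l-5)/3}\Gamma\big(\tfrac{s+l+3r+2}{3l}\big)^{-1}\Gamma\big(\tfrac{s+2l+3r+2}{3l}\big)^{-1}\quad(l\equiv2\bmod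 3),$$ $$H_l(s)=\exp\big(\tfrac{2s}{3l}\log\tfrac l3\big)\prod_{r=0}^{(l-3)/3}\Gamma_2\big(\tfrac{s+l+3r}{l}\big)\Gamma_2\big(\tfrac{s+l+3r+2}{l}\big)^{-1}\quad(l\equiv0\bmod 3).$$ Finally put $$\Xi_{\mathrm{ell}}(s)=\Big\{\Gamma\big(\tfrac s2\big)^{-1}\Gamma\big(\tfrac{s+1}2\big)\Big\}^{\nu_2/2}\Big\{\Gamma\big(\tfrac s3\big)^{-1}\Gamma\big(\tfrac{s+2}3\big)\Big\}^{2\nu_3/3},\qquad \Xi_{l\infty,\mathrm{ell}}(s)=\exp\Big\{\frac{\nu_2}2\log G_l(s)+\frac{2\nu_3}3\log H_l(s)\Big\},$$ where powers and logarithms are the holomorphic branches, real for real $s$, on $\mathrm{Re}(s)>0$ and on $\mathrm{Re}(s)>-l$ respectively (the functions have neither zeros nor poles there). Then, for $\mathrm{Re}(s)>\frac{1-l}2$, the series $\phi_s(r)$ converges absolutely for every real $r$, the integrals below converge absolutely, and $$\frac{\nu_2}4\int_{-\infty}^\infty \frac{h(r)\,dr}{e^{\pi r}+e^{-\pi r}}+\frac{\nu_3}{3\sqrt3}\int_{-\infty}^\infty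 h(r)\frac{e^{\pi r/3}+e^{-\pi r/3}}{e^{\pi r}+e^{-\pi r}}\,dr=\frac{d^2}{ds^2}\log\Xi_{l\infty,\mathrm{ell}}(s)-\frac1l\frac d{ds}\log\Xi_{\mathrm{ell}}\big(s+\tfrac l2\big).$$ Furthermore, for $\mathrm{Re}(s)>1-l$, $$\Xi_{l\infty,\mathrm{ell}}(s)=\frac{\Xi_{l\infty,\mathrm{ell}}(s+l)}{\Xi_{\mathrm{ell}}(s+l)}.$$ -/

import Mathlib

noncomputable section

namespace HigherSelberg

open MeasureTheory

/-! ### Elliptic classes of a subgroup of `SL(2, ℤ)` -/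

/-- `PSL(2, ℤ) = SL(2, ℤ) / {±1}`. -/
abbrev PSL2Z : Type := Matrix.ProjectiveSpecialLinearGroup (Fin 2) ℤ

/-- The class in `PSL(2, ℤ)` of a matrix. -/
def toPSL : Matrix.SpecialLinearGroup (Fin 2) ℤ →* PSL2Z :=
  QuotientGroup.mk' (Subgroup.center (Matrix.SpecialLinearGroup (Fin 2) ℤ))

/-- The transformation group of the upper half plane defined by `Γ`,
i.e. the image of `Γ` in `PSL(2, ℤ)`. -/
def projGroup (Γ : Subgroup (Matrix.SpecialLinearGroup (Fin 2) ℤ)) : Subgroup PSL2Z :=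
  Γ.map toPSL

/-- `R` is a primitive elliptic transformation of order `m` in `Γ`: it is the class of a matrix
of `Γ` with `|trace| < 2`, it has order `m`, and it is not a proper power in the sense that every
element of the transformation group of which it is a power generates the same cyclic group. -/
def IsPrimitiveElliptic (Γ : Subgroup (Matrix.SpecialLinearGroup (Fin 2) ℤ)) (m : ℕ)
    (R : PSL2Z) : Prop :=
  (∃ γ ∈ Γ, |Matrix.trace (γ : Matrix (Fin 2) (Fin 2) ℤ)| < 2 ∧ toPSL γ = R) ∧
  orderOf R = m ∧
  ∀ S ∈ projGroup Γ, R ∈ Subgroup.zpowers S → Subgroup.zpowers S = Subgroup.zpowers R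

/-- The conjugacy class, under the transformation group of `Γ`, of a subgroup `C`. -/
def conjClass (Γ : Subgroup (Matrix.SpecialLinearGroup (Fin 2) ℤ)) (C : Subgroup PSL2Z) :
    Set (Subgroup PSL2Z) :=
  {D | ∃ g ∈ projGroup Γ, D = C.map (MulAut.conj g).toMonoidHom}

/-- The number of primitive elliptic classes of order `m` of `Γ`. As usual the generators `R` and
`R⁻¹` of one cyclic group of order `3` (rotations about one elliptic point) count once, so
the conjugacy classes of the cyclic groups generated by primitive elliptic elements are counted;
for `Γ = SL(2, ℤ)` there is one class for `m = 2` and one for `m = 3`. -/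
def ellipticNumber (Γ : Subgroup (Matrix.SpecialLinearGroup (Fin 2) ℤ)) (m : ℕ) : ℕ :=
  Set.ncard {A : Set (Subgroup PSL2Z) |
    ∃ R, IsPrimitiveElliptic Γ m R ∧ A = conjClass Γ (Subgroup.zpowers R)}

/-! ### The test function and the elliptic terms of the trace formula -/

/-- The `m`-th term of the series `φ_s(r)`. -/
def phiTerm (l : ℕ) (s r : ℂ) (m : ℕ) : ℂ :=
  1 / (s + l * m + l - 1 / 2 + Complex.I * r) ^ 2
    - 1 / l * (1 / (s + l * m + l / 2 - 1 / 2 + Complex.I * r))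
    + 1 / l * (1 / (s + l * m + 3 * l / 2 - 1 / 2 + Complex.I * r))

/-- `φ_s(r)`. -/
def phi (l : ℕ) (s r : ℂ) : ℂ := ∑' m : ℕ, phiTerm l s r m

/-- The test function `h(r) = φ_s(r) + φ_s(-r)`. -/
def testFun (l : ℕ) (s r : ℂ) : ℂ := phi l s r + phi l s (-r)

/-- The integral kernel attached to elliptic classes of order `2`. -/
def kernel2 (r : ℝ) : ℝ := 1 / (Real.exp (Real.pi * r) + Real.exp (-(Real.pi * r)))

/-- The integral kernel attached to elliptic classes of order `3`. -/
def kernel3 (r : ℝ) : ℝ :=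
  (Real.exp (Real.pi * r / 3) + Real.exp (-(Real.pi * r / 3))) /
    (Real.exp (Real.pi * r) + Real.exp (-(Real.pi * r)))

/-- The elliptic terms (orders `2` and `3`) of the trace formula of `Γ`, evaluated at `h`. -/
def ellipticTerms (Γ : Subgroup (Matrix.SpecialLinearGroup (Fin 2) ℤ)) (h : ℂ → ℂ) : ℂ :=
  (ellipticNumber Γ 2 : ℂ) / 4 * (∫ r : ℝ, h r * (kernel2 r : ℂ))
    + (ellipticNumber Γ 3 : ℂ) / (3 * (Real.sqrt 3 : ℂ)) * (∫ r : ℝ, h r * (kernel3 r : ℂ))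

/-! ### Gamma factors -/

/-- The Weierstrass product of `1 / Γ₂(z + 1)`. -/
def invGamma2Succ (z : ℂ) : ℂ :=
  Complex.exp ((-(1 / 2) - (Real.eulerMascheroniConstant : ℂ) / 2) * z ^ 2
      + (-(1 / 2) - deriv riemannZeta 0) * z) *
    ∏' k : ℕ, (1 + z / ((k : ℂ) + 1)) ^ (k + 1) *
      Complex.exp (-z + z ^ 2 / (2 * ((k : ℂ) + 1)))

/-- The Barnes–Vignéras double gamma function `Γ₂`. -/
def Gamma2 (z : ℂ) : ℂ := (invGamma2Succ (z - 1))⁻¹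

/-- `G_l(s)`. -/
def G (l : ℕ) (s : ℂ) : ℂ :=
  if l % 2 = 1 then
    Complex.exp (s / (2 * l) * (Real.log l : ℂ)) *
      ∏ r ∈ Finset.range l, Complex.Gamma ((s + l + r) / (2 * l)) ^ ((-1 : ℤ) ^ r)
  else
    Complex.exp (s / (2 * l) * (Real.log ((l : ℝ) / 2) : ℂ)) *
      ∏ r ∈ Finset.range l, Gamma2 ((s + l + r) / l) ^ ((-1 : ℤ) ^ r)

/-- `H_l(s)`. With `q = ⌊l / 3⌋` one has `(l - 1) / 3 = q` and `(l - 4) / 3 = q - 1` if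
`l ≡ 1 (mod 3)`, `(l - 2) / 3 = q` and `(l - 5) / 3 = q - 1` if `l ≡ 2 (mod 3)`, and
`(l - 3) / 3 = q - 1` if `3 ∣ l`; these are the upper limits of the products. -/
def H (l : ℕ) (s : ℂ) : ℂ :=
  if l % 3 = 1 then
    Complex.exp (2 * s / (3 * l) * (Real.log l : ℂ)) *
      (∏ r ∈ Finset.range (l / 3 + 1),
        Complex.Gamma ((s + l + 3 * r) / (3 * l)) *
          Complex.Gamma ((s + 2 * l + 3 * r) / (3 * l))) *
      ∏ r ∈ Finset.range (l / 3),
        (Complex.Gamma ((s + l + 3 * r + 2) / (3 * l)))⁻¹ *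
          (Complex.Gamma ((s + 2 * l + 3 * r + 1) / (3 * l)))⁻¹
  else if l % 3 = 2 then
    Complex.exp (2 * s / (3 * l) * (Real.log l : ℂ)) *
      (∏ r ∈ Finset.range (l / 3 + 1),
        Complex.Gamma ((s + l + 3 * r) / (3 * l)) *
          Complex.Gamma ((s + 2 * l + 3 * r + 1) / (3 * l))) *
      ∏ r ∈ Finset.range (l / 3),
        (Complex.Gamma ((s + l + 3 * r + 2) / (3 * l)))⁻¹ *
          (Complex.Gamma ((s + 2 * l + 3 * r + 2) / (3 * l)))⁻¹
  else
    Complex.exp (2 * s / (3 * l) * (Real.log ((l : ℝ) / 3) : ℂ)) *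
      ∏ r ∈ Finset.range (l / 3),
        Gamma2 ((s + l + 3 * r) / l) * (Gamma2 ((s + l + 3 * r + 2) / l))⁻¹

/-- `Γ(s/2)⁻¹ Γ((s+1)/2)`. -/
def E2 (s : ℂ) : ℂ := (Complex.Gamma (s / 2))⁻¹ * Complex.Gamma ((s + 1) / 2)

/-- `Γ(s/3)⁻¹ Γ((s+2)/3)`. -/
def E3 (s : ℂ) : ℂ := (Complex.Gamma (s / 3))⁻¹ * Complex.Gamma ((s + 2) / 3)

/-- The branch of `log f` obtained by continuation along the segment from `1` to `s`, starting from
the principal value at `1`. If `f` is holomorphic and zero-free on a half plane containing `1` this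
is the holomorphic logarithm of `f` there; if moreover `f` is positive on the real points of the
half plane, it is the branch which is real there. -/
def logBranch (f : ℂ → ℂ) (s : ℂ) : ℂ :=
  Complex.log (f 1) + ∫ t in (0 : ℝ)..1, (s - 1) * logDeriv f (1 + t * (s - 1))

/-- `L` is a holomorphic logarithm of `f` on the half plane `Re s > a`. -/
def IsHolLogOn (L f : ℂ → ℂ) (a : ℝ) : Prop :=
  DifferentiableOn ℂ L {s | a < s.re} ∧ ∀ s : ℂ, a < s.re → Complex.exp (L s) = f s

/-- The elliptic gamma factor of the Selberg zeta function of `Γ`: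
`E2 ^ (ν₂ / 2) * E3 ^ (2 ν₃ / 3)`. -/
def XiEll (Γ : Subgroup (Matrix.SpecialLinearGroup (Fin 2) ℤ)) (s : ℂ) : ℂ :=
  Complex.exp ((ellipticNumber Γ 2 : ℂ) / 2 * logBranch E2 s) *
    Complex.exp (2 * (ellipticNumber Γ 3 : ℂ) / 3 * logBranch E3 s)

/-- The elliptic gamma factor of the higher Selberg zeta function of `Γ`. -/
def XiHigherEll (Γ : Subgroup (Matrix.SpecialLinearGroup (Fin 2) ℤ)) (l : ℕ) (s : ℂ) : ℂ :=
  Complex.exp ((ellipticNumber Γ 2 : ℂ) / 2 * logBranch (G l) s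
    + 2 * (ellipticNumber Γ 3 : ℂ) / 3 * logBranch (H l) s)

end HigherSelberg

end

open Complex MeasureTheory Filter Topology

noncomputable section

namespace HigherSelberg

/-! Both elliptic kernels are even, and on `t > 0` their Fourier transforms have the common shape `C
e^{-t/2} (1 - e^{-ct}) / (1 - e^{-dt})`, with `(C, c, d) = (1, 1, 2)` for order 2 and `(√3, 2, 3)`
for order 3. Writing `1 / (a + ir)` as a Laplace integral and exchanging the integrals turns `∫ k(r)
/ (a + ir)` into `C ∑ₙ (1 / (b + dn) - 1 / (b + c + dn))` with `b = a + 1/2`. This is `C` times the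
logarithmic derivative at `b` of `E(s) = Γ(s/d)⁻¹ Γ((s+c)/d)`, which is `E2` or `E3`
(`IsEllipticKernel.integral_div`). Differentiating in `a` gives the integral against `1 / (a + ir)²`
as `-C (log E)''(b)` (`integral_div_sq`).

The other ingredient is the ladder relation `F(s + l) = F(s) E(s + l)` for `F = G_l` or `H_l`
(`G_add`, `H_add`). It comes from the multiplication theorem for `Γ` and, when 2 or 3 divides `l`,
from the recursion `Γ₂(w + 1) = c Γ₂(w) / Γ(w)`. The constants in both are never evaluated, because
only quotients occur. By the ladder, `(log E)''(s + lm + l)` is a difference of two values of `(log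
F)''`. The two linear fractions in each term of `φ_s` are also consecutive members of one sequence.
So the integral of the `m`-th term is `u m - u (m + 1)`, and the sum over `m` is `u 0` provided `u`
tends to 0 (`integral_testFun`). This explains why decay of `(log F)''` as `Re s → ∞` is part of
`HasRealLog`. Evenness of the kernel doubles the result.

Branches are controlled by `IsRealLog`: logarithms are built as explicit Weierstrass series, and
reality on the real axis identifies them with `logBranch`. Hence multiplicative identities pass to
the chosen logarithms without multiples of `2πi`. -/

/-- `L` is a logarithm of `f` on `Re s > a` which is real on the real axis, with first and second
derivatives `L'` and `L''`. -/
structure IsRealLog (f L L' L'' : ℂ → ℂ) (a : ℝ) : Prop where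
  exp_eq : ∀ s : ℂ, a < s.re → Complex.exp (L s) = f s
  hasDerivAt : ∀ s : ℂ, a < s.re → HasDerivAt L (L' s) s
  hasDerivAt' : ∀ s : ℂ, a < s.re → HasDerivAt L' (L'' s) s
  im_eq_zero : ∀ x : ℝ, a < x → (L x).im = 0

theorem eventually_lt_re {a : ℝ} {s : ℂ} (hs : a < s.re) : ∀ᶠ z in 𝓝 s, a < z.re :=
  (isOpen_lt continuous_const Complex.continuous_re).mem_nhds hs

/-! ### Calculus of logarithms normalised to be real on the real axis. -/

namespace IsRealLog

variable {f g L L' L'' M M' M'' : ℂ → ℂ} {a b : ℝ}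

theorem congr (h : IsRealLog f L L' L'' a) (hfg : ∀ s : ℂ, a < s.re → f s = g s) :
    IsRealLog g L L' L'' a :=
  ⟨fun s hs => (h.exp_eq s hs).trans (hfg s hs), h.hasDerivAt, h.hasDerivAt', h.im_eq_zero⟩

theorem ne_zero (h : IsRealLog f L L' L'' a) {s : ℂ} (hs : a < s.re) : f s ≠ 0 := by
  rw [← h.exp_eq s hs]; exact Complex.exp_ne_zero _

theorem hasDerivAt_self (h : IsRealLog f L L' L'' a) {s : ℂ} (hs : a < s.re) :
    HasDerivAt f (f s * L' s) s := by
  have := (h.hasDerivAt s hs).cexp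
  rw [h.exp_eq s hs] at this
  refine this.congr_of_eventuallyEq ?_
  filter_upwards [eventually_lt_re hs] with z hz using (h.exp_eq z hz).symm

theorem logDeriv_eq (h : IsRealLog f L L' L'' a) {s : ℂ} (hs : a < s.re) :
    logDeriv f s = L' s := by
  rw [logDeriv_apply, (h.hasDerivAt_self hs).deriv, mul_div_cancel_left₀ _ (h.ne_zero hs)]

/-- Since `L 1` is real it is the principal logarithm of `f 1`; integrating `L'` along the segment
from 1 to `s`, which stays in the half plane, gives the rest. -/
theorem logBranch_eq (h : IsRealLog f L L' L'' a) (ha : a < 1) {s : ℂ} (hs : a < s.re) :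
    logBranch f s = L s := by
  have hre : ∀ t ∈ Set.uIcc (0 : ℝ) 1, a < ((1 : ℂ) + t * (s - 1)).re := by
    intro t ht
    rw [Set.uIcc_of_le zero_le_one] at ht
    simp only [add_re, one_re, mul_re, ofReal_re, sub_re, ofReal_im, zero_mul, sub_zero]
    rcases le_total s.re 1 with h1 | h1 <;> nlinarith [ht.1, ht.2]
  have hlog : Complex.log (f 1) = L 1 := by
    have h1 := h.im_eq_zero 1 ha
    rw [ofReal_one] at h1
    rw [← h.exp_eq 1 (by simpa using ha), Complex.log_exp] <;> rw [h1]
    · simpa using Real.pi_pos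
    · exact Real.pi_pos.le
  have hd : ∀ t ∈ Set.uIcc (0 : ℝ) 1, HasDerivAt (fun t : ℝ => L (1 + t * (s - 1)))
      ((s - 1) * L' (1 + t * (s - 1))) t := by
    intro t ht
    have h1 : HasDerivAt (fun t : ℝ => (1 : ℂ) + t * (s - 1)) (s - 1) t := by
      simpa using ((hasDerivAt_id t).ofReal_comp.mul_const (s - 1)).const_add 1
    have := (h.hasDerivAt _ (hre t ht)).comp t h1
    rwa [mul_comm] at this
  have hc : ContinuousOn (fun t : ℝ => (s - 1) * L' (1 + t * (s - 1))) (Set.uIcc 0 1) := by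
    intro t ht
    have h1 : ContinuousAt (fun t : ℝ => (1 : ℂ) + t * (s - 1)) t := by fun_prop
    exact (continuousAt_const.mul
      (ContinuousAt.comp (f := fun t : ℝ => (1 : ℂ) + t * (s - 1))
        (h.hasDerivAt' _ (hre t ht)).continuousAt h1)).continuousWithinAt
  have hint := intervalIntegral.integral_eq_sub_of_hasDerivAt hd hc.intervalIntegrable
  have hcong : (∫ t in (0 : ℝ)..1, (s - 1) * logDeriv f (1 + t * (s - 1))) =
      ∫ t in (0 : ℝ)..1, (s - 1) * L' (1 + t * (s - 1)) :=
    intervalIntegral.integral_congr fun t ht => by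
      simp only [h.logDeriv_eq (hre t ht)]
  rw [logBranch, hcong, hint, hlog]
  simp

theorem isHolLogOn (h : IsRealLog f L L' L'' a) (ha : a < 1) : IsHolLogOn (logBranch f) f a := by
  refine ⟨fun s hs => ?_, fun s hs => ?_⟩
  · refine DifferentiableAt.differentiableWithinAt ?_
    refine ((h.hasDerivAt s hs).differentiableAt).congr_of_eventuallyEq ?_
    filter_upwards [eventually_lt_re hs] with z hz using h.logBranch_eq ha hz
  · rw [h.logBranch_eq ha hs, h.exp_eq s hs]

theorem unique (h : IsRealLog f L L' L'' a) (h' : IsRealLog f M M' M'' a) (ha : a < 1) {s : ℂ}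
    (hs : a < s.re) : L s = M s := by
  rw [← h.logBranch_eq ha hs, h'.logBranch_eq ha hs]

theorem deriv_logDeriv_eq (h : IsRealLog f L L' L'' a) {s : ℂ} (hs : a < s.re) :
    deriv (logDeriv f) s = L'' s := by
  refine ((h.hasDerivAt' s hs).congr_of_eventuallyEq ?_).deriv
  filter_upwards [eventually_lt_re hs] with z hz using h.logDeriv_eq hz

/-- Derivatives do not see the additive constant, so the base point 1 need not lie in the half
plane. -/
theorem unique'' (h : IsRealLog f L L' L'' a) (h' : IsRealLog f M M' M'' a) {s : ℂ}
    (hs : a < s.re) : L'' s = M'' s := by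
  rw [← h.deriv_logDeriv_eq hs, h'.deriv_logDeriv_eq hs]

theorem mul (h : IsRealLog f L L' L'' a) (h' : IsRealLog g M M' M'' a) :
    IsRealLog (fun s => f s * g s) (fun s => L s + M s) (fun s => L' s + M' s)
      (fun s => L'' s + M'' s) a :=
  ⟨fun s hs => by rw [Complex.exp_add, h.exp_eq s hs, h'.exp_eq s hs],
    fun s hs => (h.hasDerivAt s hs).add (h'.hasDerivAt s hs),
    fun s hs => (h.hasDerivAt' s hs).add (h'.hasDerivAt' s hs),
    fun x hx => by rw [add_im, h.im_eq_zero x hx, h'.im_eq_zero x hx, add_zero]⟩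

theorem inv (h : IsRealLog f L L' L'' a) :
    IsRealLog (fun s => (f s)⁻¹) (fun s => -L s) (fun s => -L' s) (fun s => -L'' s) a :=
  ⟨fun s hs => by rw [Complex.exp_neg, h.exp_eq s hs],
    fun s hs => (h.hasDerivAt s hs).neg, fun s hs => (h.hasDerivAt' s hs).neg,
    fun x hx => by rw [neg_im, h.im_eq_zero x hx, neg_zero]⟩

theorem zpow (h : IsRealLog f L L' L'' a) (n : ℤ) :
    IsRealLog (fun s => f s ^ n) (fun s => n * L s) (fun s => n * L' s) (fun s => n * L'' s) a :=
  ⟨fun s hs => by rw [Complex.exp_int_mul, h.exp_eq s hs],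
    fun s hs => (h.hasDerivAt s hs).const_mul _, fun s hs => (h.hasDerivAt' s hs).const_mul _,
    fun x hx => by simp [h.im_eq_zero x hx]⟩

theorem prod {ι : Type*} (t : Finset ι) {f L L' L'' : ι → ℂ → ℂ}
    (h : ∀ i ∈ t, IsRealLog (f i) (L i) (L' i) (L'' i) a) :
    IsRealLog (fun s => ∏ i ∈ t, f i s) (fun s => ∑ i ∈ t, L i s) (fun s => ∑ i ∈ t, L' i s)
      (fun s => ∑ i ∈ t, L'' i s) a :=
  ⟨fun s hs => by
      rw [Complex.exp_sum]; exact Finset.prod_congr rfl fun i hi => (h i hi).exp_eq s hs,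
    fun s hs => HasDerivAt.fun_sum fun i hi => (h i hi).hasDerivAt s hs,
    fun s hs => HasDerivAt.fun_sum fun i hi => (h i hi).hasDerivAt' s hs,
    fun x hx => by
      rw [Complex.im_sum]; exact Finset.sum_eq_zero fun i hi => (h i hi).im_eq_zero x hx⟩

/-- Substitution `s ↦ (s + c) / d`. -/
theorem comp_affine (h : IsRealLog f L L' L'' a) (c d : ℝ) (hd : 0 < d) (hb : d * a - c ≤ b) :
    IsRealLog (fun s => f ((s + c) / d)) (fun s => L ((s + c) / d))
      (fun s => (d : ℂ)⁻¹ * L' ((s + c) / d)) (fun s => (d : ℂ)⁻¹ * ((d : ℂ)⁻¹ * L'' ((s + c) / d)))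
      b := by
  have hre : ∀ s : ℂ, b < s.re → a < ((s + c) / d).re := by
    intro s hs
    rw [Complex.div_ofReal_re, add_re, ofReal_re, lt_div_iff₀ hd]
    nlinarith
  have haff : ∀ s : ℂ, HasDerivAt (fun s : ℂ => (s + c) / d) ((d : ℂ)⁻¹) s := fun s => by
    simpa using ((hasDerivAt_id s).add_const (c : ℂ)).div_const (d : ℂ)
  refine ⟨fun s hs => h.exp_eq _ (hre s hs), fun s hs => ?_, fun s hs => ?_, fun x hx => ?_⟩
  · rw [mul_comm]
    exact (h.hasDerivAt _ (hre s hs)).comp s (haff s)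
  · rw [mul_comm (d : ℂ)⁻¹ (L'' _)]
    exact ((h.hasDerivAt' _ (hre s hs)).comp s (haff s)).const_mul _
  · have := h.im_eq_zero ((x + c) / d) (by simpa using hre x (by simpa using hx))
    simpa using this

theorem exp_mul (c : ℝ) (a : ℝ) :
    IsRealLog (fun s => Complex.exp (s * c)) (fun s => s * c) (fun _ => c) (fun _ => 0) a :=
  ⟨fun _ _ => rfl, fun s _ => by simpa using (hasDerivAt_id s).mul_const (c : ℂ),
    fun s _ => hasDerivAt_const s _, fun x _ => by simp⟩

end IsRealLog

/-! ### Series of holomorphic functions on the right half plane. -/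

theorem natCast_add_ne_zero (k : ℕ) {w : ℂ} (hw : 0 < w.re) : (k : ℂ) + w ≠ 0 := by
  intro h
  have := congrArg Complex.re h
  simp only [add_re, natCast_re, zero_re] at this
  have : (0 : ℝ) ≤ k := k.cast_nonneg
  linarith

theorem natCast_add_re_le_norm (k : ℕ) (w : ℂ) : (k : ℝ) + w.re ≤ ‖(k : ℂ) + w‖ := by
  simpa using Complex.re_le_norm ((k : ℂ) + w)

theorem mul_succ_le_norm_natCast_add (k : ℕ) {w : ℂ} {ε : ℝ} (hε1 : ε ≤ 1) (hw : ε ≤ w.re) :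
    ε * (k + 1) ≤ ‖(k : ℂ) + w‖ := by
  have h1 := natCast_add_re_le_norm k w
  have : (0 : ℝ) ≤ k := k.cast_nonneg
  nlinarith

theorem summable_div_succ_sq (C : ℝ) : Summable fun k : ℕ => C / ((k : ℝ) + 1) ^ 2 := by
  have h := (summable_nat_add_iff 1).mpr (Real.summable_one_div_nat_pow.mpr one_lt_two)
  simpa [div_eq_mul_inv] using h.mul_left C

/-- Termwise differentiation on the right half plane. -/
theorem hasDerivAt_tsum_of_re_pos {g g' : ℕ → ℂ → ℂ} {C : ℝ → ℝ → ℝ}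
    (hg : ∀ k w, 0 < w.re → HasDerivAt (g k) (g' k w) w)
    (hb : ∀ ε R k w, 0 < ε → ε ≤ 1 → ε ≤ w.re → ‖w‖ ≤ R →
      ‖g' k w‖ ≤ C ε R / ((k : ℝ) + 1) ^ 2)
    (h1 : Summable fun k => g k 1) {w : ℂ} (hw : 0 < w.re) :
    (Summable fun k => g k w) ∧ HasDerivAt (fun z => ∑' k, g k z) (∑' k, g' k w) w := by
  obtain ⟨ε, hε0, hε⟩ := exists_between (lt_min hw one_pos)
  obtain ⟨hεw, hε1⟩ := lt_min_iff.mp hε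
  obtain ⟨R, hR⟩ := exists_gt (max ‖w‖ 1)
  obtain ⟨hRw, hR1⟩ := max_lt_iff.mp hR
  -- A convex open set on which the derivative bound is uniform, containing both `w` and the point 1
  -- where convergence is given.
  set t : Set ℂ := {z : ℂ | ε < z.re} ∩ Metric.ball 0 R with ht
  have hto : IsOpen t := (isOpen_lt continuous_const Complex.continuous_re).inter Metric.isOpen_ball
  have htc : IsPreconnected t :=
    ((convex_halfSpace_re_gt ε).inter (convex_ball 0 R)).isPreconnected
  have h1t : (1 : ℂ) ∈ t := ⟨by simpa using hε1, by simpa using hR1⟩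
  have hwt : w ∈ t := ⟨hεw, by simpa using hRw⟩
  have hg1 : ∀ k z, z ∈ t → HasDerivAt (g k) (g' k z) z := fun k z hz =>
    hg k z (hε0.trans hz.1)
  have hg2 : ∀ k z, z ∈ t → ‖g' k z‖ ≤ C ε R / ((k : ℝ) + 1) ^ 2 := fun k z hz =>
    hb ε R k z hε0 hε1.le (le_of_lt hz.1) (by simpa using (Metric.mem_ball.mp hz.2).le)
  exact ⟨summable_of_summable_hasDerivAt_of_isPreconnected (summable_div_succ_sq _) hto htc hg1
      hg2 h1t h1 hwt,
    hasDerivAt_tsum_of_isPreconnected (summable_div_succ_sq _) hto htc hg1 hg2 h1t h1 hwt⟩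

/-! ### The logarithm of the gamma function -/

/-- The terms of the Weierstrass series of `log Γ`. -/
def logGammaTerm (k : ℕ) (w : ℂ) : ℂ :=
  (w - 1) / (k + 1) - Complex.log (1 + (w - 1) / (k + 1))

/-- The logarithm of `Γ` on the right half plane. -/
def logGamma (w : ℂ) : ℂ :=
  -(Real.eulerMascheroniConstant : ℂ) * (w - 1) + ∑' k, logGammaTerm k w

/-- The logarithmic derivative of `Γ` on the right half plane. -/
def digammaSeries (w : ℂ) : ℂ :=
  -(Real.eulerMascheroniConstant : ℂ) + ∑' k : ℕ, (1 / ((k : ℂ) + 1) - 1 / (k + w))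

/-- The derivative of the logarithmic derivative of `Γ` on the right half plane. -/
def trigamma (w : ℂ) : ℂ := ∑' k : ℕ, 1 / ((k : ℂ) + w) ^ 2

theorem one_add_sub_one_div (k : ℕ) (w : ℂ) :
    1 + (w - 1) / ((k : ℂ) + 1) = (k + w) / (k + 1) := by
  have : (k : ℂ) + 1 ≠ 0 := k.cast_add_one_ne_zero
  field_simp
  ring

theorem one_add_sub_one_div_mem_slitPlane (k : ℕ) {w : ℂ} (hw : 0 < w.re) :
    1 + (w - 1) / ((k : ℂ) + 1) ∈ slitPlane := by
  left
  rw [one_add_sub_one_div]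
  have h : ((k : ℂ) + 1) = ((k + 1 : ℝ) : ℂ) := by push_cast; rfl
  rw [h, Complex.div_ofReal_re, add_re, natCast_re]
  positivity

theorem hasDerivAt_log_one_add (k : ℕ) {w : ℂ} (hw : 0 < w.re) :
    HasDerivAt (fun w : ℂ => Complex.log (1 + (w - 1) / ((k : ℂ) + 1))) (1 / (k + w)) w := by
  have h := ((((hasDerivAt_id w).sub_const 1).div_const ((k : ℂ) + 1)).const_add 1).clog
    (one_add_sub_one_div_mem_slitPlane k hw)
  refine h.congr_deriv ?_
  simp only [id]
  rw [one_add_sub_one_div]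
  have : (k : ℂ) + 1 ≠ 0 := k.cast_add_one_ne_zero
  have := natCast_add_ne_zero k hw
  field_simp

theorem hasDerivAt_one_div_natCast_add (k : ℕ) {w : ℂ} (hw : 0 < w.re) :
    HasDerivAt (fun w : ℂ => 1 / ((k : ℂ) + w)) (-1 / ((k : ℂ) + w) ^ 2) w := by
  have := ((hasDerivAt_id w).const_add (k : ℂ)).inv (natCast_add_ne_zero k hw)
  simp only [one_div]
  exact this

theorem summable_and_hasDerivAt_logGammaTerm {w : ℂ} (hw : 0 < w.re) :
    (Summable fun k => logGammaTerm k w) ∧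
      HasDerivAt (fun z => ∑' k, logGammaTerm k z)
        (∑' k : ℕ, (1 / ((k : ℂ) + 1) - 1 / (k + w))) w := by
  refine hasDerivAt_tsum_of_re_pos (g := logGammaTerm)
    (g' := fun k w => 1 / ((k : ℂ) + 1) - 1 / (k + w))
    (C := fun ε R => (R + 1) / ε) (fun k w hw => ?_)
    (fun ε R k w hε hε1 hw hR => ?_) ?_ hw
  · exact (((hasDerivAt_id w).sub_const 1).div_const ((k : ℂ) + 1)).sub
      (hasDerivAt_log_one_add k hw)
  · have hk : (k : ℂ) + 1 ≠ 0 := k.cast_add_one_ne_zero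
    have hkw := natCast_add_ne_zero k (hε.trans_le hw)
    have h1 : 1 / ((k : ℂ) + 1) - 1 / (k + w) = (w - 1) / ((k + 1) * (k + w)) := by
      field_simp; ring
    have h2 : ‖(k : ℂ) + 1‖ = k + 1 := by
      rw [← Nat.cast_add_one, Complex.norm_natCast]; push_cast; rfl
    have h3 : ‖w - 1‖ ≤ R + 1 := (norm_sub_le _ _).trans (by simpa using hR)
    have hR0 : 0 ≤ R := (norm_nonneg w).trans hR
    rw [h1, norm_div, norm_mul, h2, div_div]
    refine div_le_div₀ (by positivity) h3 (by positivity) ?_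
    have := mul_succ_le_norm_natCast_add k hε1 hw
    have hk0 : (0 : ℝ) < k + 1 := by positivity
    nlinarith
  -- The Weierstrass series is centred at `w = 1`, where every term vanishes.
  · simp [logGammaTerm]

theorem norm_one_div_sq_le {ε : ℝ} (k : ℕ) {w : ℂ} (hε : 0 < ε) (hε1 : ε ≤ 1) (hw : ε ≤ w.re) :
    ‖1 / ((k : ℂ) + w) ^ 2‖ ≤ 1 / ε ^ 2 / ((k : ℝ) + 1) ^ 2 := by
  rw [norm_div, norm_one, norm_pow, div_div, ← mul_pow]
  have := mul_succ_le_norm_natCast_add k hε1 hw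
  gcongr

theorem summable_and_hasDerivAt_digammaTerm {w : ℂ} (hw : 0 < w.re) :
    (Summable fun k : ℕ => 1 / ((k : ℂ) + 1) - 1 / (k + w)) ∧
      HasDerivAt (fun z => ∑' k : ℕ, (1 / ((k : ℂ) + 1) - 1 / (k + z))) (trigamma w) w := by
  refine hasDerivAt_tsum_of_re_pos (g := fun k w => 1 / ((k : ℂ) + 1) - 1 / (k + w))
    (g' := fun k w => 1 / ((k : ℂ) + w) ^ 2)
    (C := fun ε R => 1 / ε ^ 2) (fun k w hw => ?_)
    (fun ε R k w hε hε1 hw hR => norm_one_div_sq_le k hε hε1 hw) ?_ hw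
  · refine ((hasDerivAt_one_div_natCast_add k hw).const_sub _).congr_deriv ?_
    ring
  · simp

theorem exp_logGammaTerm (k : ℕ) {w : ℂ} (hw : 0 < w.re) :
    Complex.exp (logGammaTerm k w) = Complex.exp ((w - 1) / (k + 1)) * ((k + 1) / (k + w)) := by
  rw [logGammaTerm, Complex.exp_sub, Complex.exp_log
    (Complex.slitPlane_ne_zero (one_add_sub_one_div_mem_slitPlane k hw)), one_add_sub_one_div,
    div_div_eq_mul_div, mul_div_assoc]

/-- The exponentiated partial sums are compared with Euler's sequence `GammaSeq`, whose limit is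
`Γ`. -/
theorem exp_logGamma {w : ℂ} (hw : 0 < w.re) : Complex.exp (logGamma w) = Complex.Gamma w := by
  have hS := (summable_and_hasDerivAt_logGammaTerm hw).1.hasSum.tendsto_sum_nat
  have hP : ∀ n : ℕ, ∏ k ∈ Finset.range n, (((k : ℂ) + 1) / (k + w)) =
      (n.factorial : ℂ) / ∏ k ∈ Finset.range n, (w + k) := by
    intro n
    rw [Finset.prod_div_distrib]
    congr 1
    · rw [← Finset.prod_range_add_one_eq_factorial]; push_cast; rfl
    · exact Finset.prod_congr rfl fun k _ => add_comm _ _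
  have hsum : ∀ n : ℕ, ∑ k ∈ Finset.range n, (w - 1) / ((k : ℂ) + 1) =
      (w - 1) * ((harmonic n : ℝ) : ℂ) := by
    intro n
    rw [harmonic, Rat.cast_sum, ofReal_sum, Finset.mul_sum]
    refine Finset.sum_congr rfl fun k _ => ?_
    push_cast
    rw [div_eq_mul_inv]
  -- `GammaSeq w n` has `n + 1` factors in its denominator, hence the harmonic number of index `n +
  -- 1`.
  have hE : Tendsto (fun n : ℕ => Complex.exp ((w - 1) * ((Real.log n : ℝ) : ℂ) -
      (w - 1) * ((harmonic (n + 1) : ℝ) : ℂ))) atTop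
      (𝓝 (Complex.exp (-(Real.eulerMascheroniConstant : ℂ) * (w - 1)))) := by
    have h0 : Tendsto (fun n : ℕ => (harmonic (n + 1) : ℝ) - Real.log n) atTop
        (𝓝 (Real.eulerMascheroniConstant + 0)) := by
      refine (Real.tendsto_harmonic_sub_log.add tendsto_one_div_add_atTop_nhds_zero_nat).congr
        fun n => ?_
      rw [harmonic_succ]; push_cast; ring
    rw [add_zero] at h0
    have h1 := ((Complex.continuous_ofReal.tendsto _).comp h0).const_mul (-(w - 1))
    rw [show -(w - 1) * (Real.eulerMascheroniConstant : ℂ) =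
      -(Real.eulerMascheroniConstant : ℂ) * (w - 1) by ring] at h1
    refine (Complex.continuous_exp.tendsto _).comp (h1.congr fun n => ?_)
    simp only [Function.comp, ofReal_sub]
    ring
  -- This quotient reconciles `(n + 1)!` with `n!` and `n ^ w` with `n ^ (w - 1)`.
  have hN : Tendsto (fun n : ℕ => ((n : ℂ) / (n + 1))) atTop (𝓝 1) :=
    tendsto_natCast_div_add_atTop (1 : ℂ)
  refine tendsto_nhds_unique ?_ (Complex.GammaSeq_tendsto_Gamma w)
  have hlim := (hN.mul hE).mul ((Complex.continuous_exp.tendsto _).comp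
    (hS.comp (tendsto_add_atTop_nat 1)))
  rw [one_mul, ← Complex.exp_add] at hlim
  refine hlim.congr' ?_
  filter_upwards [eventually_gt_atTop 0] with n hn
  have hn0 : (n : ℂ) ≠ 0 := Nat.cast_ne_zero.mpr hn.ne'
  have hn1 : (n : ℂ) + 1 ≠ 0 := n.cast_add_one_ne_zero
  simp only [Function.comp]
  rw [Complex.exp_sum, Finset.prod_congr rfl fun k _ => exp_logGammaTerm k hw,
    Finset.prod_mul_distrib, hP, ← Complex.exp_sum, hsum, Complex.GammaSeq, Complex.exp_sub,
    Nat.factorial_succ]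
  have hc : (n : ℂ) ^ w = n * Complex.exp ((w - 1) * ((Real.log n : ℝ) : ℂ)) := by
    rw [Complex.cpow_def_of_ne_zero hn0, ← Complex.natCast_log]
    have h1 : Complex.exp ((Real.log n : ℝ) : ℂ) = n := by
      rw [Complex.natCast_log, Complex.exp_log hn0]
    calc Complex.exp (((Real.log n : ℝ) : ℂ) * w)
        = Complex.exp ((Real.log n : ℝ) : ℂ) * Complex.exp ((w - 1) * ((Real.log n : ℝ) : ℂ)) := by
          rw [← Complex.exp_add]; congr 1; ring
      _ = _ := by rw [h1]
  rw [hc]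
  have := Complex.exp_ne_zero ((w - 1) * ((harmonic (n + 1) : ℝ) : ℂ))
  push_cast
  field_simp

theorem log_one_add_ofReal_im (k : ℕ) {x : ℝ} (hx : 0 < x) :
    (Complex.log (1 + ((x : ℂ) - 1) / ((k : ℂ) + 1))).im = 0 := by
  have h : (1 + ((x : ℂ) - 1) / ((k : ℂ) + 1)) = (((k + x) / (k + 1) : ℝ) : ℂ) := by
    rw [one_add_sub_one_div]; push_cast; rfl
  rw [h, ← Complex.ofReal_log (by positivity), ofReal_im]

theorem isRealLog_Gamma : IsRealLog Complex.Gamma logGamma digammaSeries trigamma 0 := by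
  refine ⟨fun s hs => exp_logGamma hs, fun s hs => ?_, fun s hs => ?_, fun x hx => ?_⟩
  · refine HasDerivAt.add ?_ (summable_and_hasDerivAt_logGammaTerm hs).2
    simpa using ((hasDerivAt_id s).sub_const 1).const_mul (-(Real.eulerMascheroniConstant : ℂ))
  · exact (summable_and_hasDerivAt_digammaTerm hs).2.const_add _
  · rw [logGamma, add_im, Complex.im_tsum (summable_and_hasDerivAt_logGammaTerm
      (by simpa using hx)).1]
    have h : ∀ k, (logGammaTerm k x).im = 0 := fun k => by
      rw [logGammaTerm, sub_im, log_one_add_ofReal_im k hx]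
      have : ((x : ℂ) - 1) / ((k : ℂ) + 1) = (((x - 1) / (k + 1) : ℝ) : ℂ) := by push_cast; rfl
      rw [this, ofReal_im, sub_zero]
    simp [h]

/-! ### The logarithm of the double gamma function -/

/-- The terms of the Weierstrass series of `-log Γ₂`. -/
def logGamma2Term (k : ℕ) (w : ℂ) : ℂ :=
  (k + 1) * Complex.log (1 + (w - 1) / (k + 1)) - (w - 1) + (w - 1) ^ 2 / (2 * (k + 1))

/-- The logarithm of `Γ₂` on the right half plane. -/
def logGamma2 (w : ℂ) : ℂ :=
  -(((-(1 / 2) - (Real.eulerMascheroniConstant : ℂ) / 2) * (w - 1) ^ 2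
      + (-(1 / 2) - deriv riemannZeta 0) * (w - 1)) + ∑' k, logGamma2Term k w)

/-- The derivative of `logGamma2`. -/
def logGamma2' (w : ℂ) : ℂ :=
  -(((-(1 / 2) - (Real.eulerMascheroniConstant : ℂ) / 2) * (2 * (w - 1))
      + (-(1 / 2) - deriv riemannZeta 0)) +
    ∑' k : ℕ, (((k : ℂ) + 1) / (k + w) - 1 + (w - 1) / (k + 1)))

/-- The second derivative of `logGamma2`. -/
def logGamma2'' (w : ℂ) : ℂ :=
  -((-(1 / 2) - (Real.eulerMascheroniConstant : ℂ) / 2) * 2 +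
    ∑' k : ℕ, (1 / ((k : ℂ) + 1) - ((k : ℂ) + 1) / (k + w) ^ 2))

theorem summable_and_hasDerivAt_logGamma2Term {w : ℂ} (hw : 0 < w.re) :
    (Summable fun k => logGamma2Term k w) ∧
      HasDerivAt (fun z => ∑' k, logGamma2Term k z)
        (∑' k : ℕ, (((k : ℂ) + 1) / (k + w) - 1 + (w - 1) / (k + 1))) w := by
  refine hasDerivAt_tsum_of_re_pos (g := logGamma2Term)
    (g' := fun k w => ((k : ℂ) + 1) / (k + w) - 1 + (w - 1) / (k + 1))
    (C := fun ε R => (R + 1) ^ 2 / ε) (fun k w hw => ?_)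
    (fun ε R k w hε hε1 hw hR => ?_) ?_ hw
  · have h0 : HasDerivAt (fun w : ℂ => w - 1) 1 w := (hasDerivAt_id w).sub_const 1
    refine ((((hasDerivAt_log_one_add k hw).const_mul ((k : ℂ) + 1)).sub h0).add
      ((h0.pow 2).div_const (2 * ((k : ℂ) + 1)))).congr_deriv ?_
    have hk : (k : ℂ) + 1 ≠ 0 := k.cast_add_one_ne_zero
    have hkw := natCast_add_ne_zero k hw
    push_cast
    field_simp
  · have hk : (k : ℂ) + 1 ≠ 0 := k.cast_add_one_ne_zero
    have hkw := natCast_add_ne_zero k (hε.trans_le hw)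
    have h1 : ((k : ℂ) + 1) / (k + w) - 1 + (w - 1) / (k + 1) =
        (w - 1) ^ 2 / ((k + 1) * (k + w)) := by
      field_simp; ring
    have h2 : ‖(k : ℂ) + 1‖ = k + 1 := by
      rw [← Nat.cast_add_one, Complex.norm_natCast]; push_cast; rfl
    have h3 : ‖w - 1‖ ≤ R + 1 := (norm_sub_le _ _).trans (by simpa using hR)
    have hR0 : 0 ≤ R := (norm_nonneg w).trans hR
    rw [h1, norm_div, norm_mul, h2, div_div, norm_pow]
    refine div_le_div₀ (by positivity) (by gcongr) (by positivity) ?_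
    have := mul_succ_le_norm_natCast_add k hε1 hw
    have hk0 : (0 : ℝ) < k + 1 := by positivity
    nlinarith
  · simp [logGamma2Term]

theorem norm_logGamma2Term''_le {ε R : ℝ} (k : ℕ) {w : ℂ} (hε : 0 < ε) (hε1 : ε ≤ 1)
    (hw : ε ≤ w.re) (hR : ‖w‖ ≤ R) :
    ‖1 / ((k : ℂ) + 1) - ((k : ℂ) + 1) / (k + w) ^ 2‖ ≤
      (R + 1) * (R + 3) / ε ^ 2 / ((k : ℝ) + 1) ^ 2 := by
  have hk : (k : ℂ) + 1 ≠ 0 := k.cast_add_one_ne_zero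
  have hkw := natCast_add_ne_zero k (hε.trans_le hw)
  have h1 : 1 / ((k : ℂ) + 1) - ((k : ℂ) + 1) / (k + w) ^ 2 =
      (w - 1) * (2 * (k + 1) + (w - 1)) / ((k + 1) * (k + w) ^ 2) := by
    field_simp; ring
  have h2 : ‖(k : ℂ) + 1‖ = k + 1 := by
    rw [← Nat.cast_add_one, Complex.norm_natCast]; push_cast; rfl
  have h3 : ‖w - 1‖ ≤ R + 1 := (norm_sub_le _ _).trans (by simpa using hR)
  have hR0 : 0 ≤ R := (norm_nonneg w).trans hR
  have hk0 : (0 : ℝ) ≤ k := k.cast_nonneg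
  have h4 : ‖2 * ((k : ℂ) + 1) + (w - 1)‖ ≤ (R + 3) * (k + 1) := by
    refine (norm_add_le _ _).trans ?_
    rw [norm_mul, h2]
    simp only [Complex.norm_ofNat]
    nlinarith
  have h5 := mul_succ_le_norm_natCast_add k hε1 hw
  rw [h1, norm_div, norm_mul, norm_mul, h2, norm_pow]
  calc ‖w - 1‖ * ‖2 * ((k : ℂ) + 1) + (w - 1)‖ / ((k + 1) * ‖(k : ℂ) + w‖ ^ 2)
      ≤ (R + 1) * ((R + 3) * (k + 1)) / ((k + 1) * (ε * (k + 1)) ^ 2) := by gcongr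
    _ = (R + 1) * (R + 3) / ε ^ 2 / ((k : ℝ) + 1) ^ 2 := by field_simp

theorem summable_and_hasDerivAt_logGamma2Term' {w : ℂ} (hw : 0 < w.re) :
    (Summable fun k : ℕ => ((k : ℂ) + 1) / (k + w) - 1 + (w - 1) / (k + 1)) ∧
      HasDerivAt (fun z => ∑' k : ℕ, (((k : ℂ) + 1) / (k + z) - 1 + (z - 1) / (k + 1)))
        (∑' k : ℕ, (1 / ((k : ℂ) + 1) - ((k : ℂ) + 1) / (k + w) ^ 2)) w := by
  refine hasDerivAt_tsum_of_re_pos (g := fun k w => ((k : ℂ) + 1) / (k + w) - 1 + (w - 1) / (k + 1))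
    (g' := fun k w => 1 / ((k : ℂ) + 1) - ((k : ℂ) + 1) / (k + w) ^ 2)
    (C := fun ε R => (R + 1) * (R + 3) / ε ^ 2) (fun k w hw => ?_)
    (fun ε R k w hε hε1 hw hR => ?_) ?_ hw
  · have h0 : HasDerivAt (fun w : ℂ => w - 1) 1 w := (hasDerivAt_id w).sub_const 1
    have h1 := (hasDerivAt_one_div_natCast_add k hw).const_mul ((k : ℂ) + 1)
    simp only [mul_one_div] at h1
    refine ((h1.sub_const 1).add (h0.div_const ((k : ℂ) + 1))).congr_deriv ?_
    ring
  · exact norm_logGamma2Term''_le k hε hε1 hw hR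
  · have : ∀ k : ℕ, ((k : ℂ) + 1) / (k + 1) = 1 := fun k => div_self k.cast_add_one_ne_zero
    simp [this]

theorem exp_logGamma2Term (k : ℕ) {w : ℂ} (hw : 0 < w.re) :
    Complex.exp (logGamma2Term k w) = (1 + (w - 1) / ((k : ℂ) + 1)) ^ (k + 1) *
      Complex.exp (-(w - 1) + (w - 1) ^ 2 / (2 * ((k : ℂ) + 1))) := by
  have h : ((k : ℂ) + 1) = ((k + 1 : ℕ) : ℂ) := by push_cast; rfl
  rw [logGamma2Term, sub_add_eq_add_sub, add_sub_assoc, Complex.exp_add]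
  nth_rewrite 1 [h]
  rw [Complex.exp_nat_mul, Complex.exp_log
    (Complex.slitPlane_ne_zero (one_add_sub_one_div_mem_slitPlane k hw))]
  congr 2
  ring

theorem exp_logGamma2 {w : ℂ} (hw : 0 < w.re) : Complex.exp (logGamma2 w) = Gamma2 w := by
  have h := (summable_and_hasDerivAt_logGamma2Term hw).1.hasSum.cexp.tprod_eq
  rw [logGamma2, Gamma2, Complex.exp_neg, Complex.exp_add, invGamma2Succ, ← h]
  congr 2
  exact tprod_congr fun k => exp_logGamma2Term k hw

/-- Needed for `logGamma2` to be real on the real axis; it follows from the closed form of `ζ'(0)`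
in terms of `log 2π`. -/
theorem deriv_riemannZeta_zero_im : (deriv riemannZeta 0).im = 0 := by
  rw [deriv_riemannZeta_zero, show (2 * (Real.pi : ℂ)) = ((2 * Real.pi : ℝ) : ℂ) by push_cast; rfl,
    ← Complex.ofReal_log (by positivity)]
  simp

theorem isRealLog_Gamma2 : IsRealLog Gamma2 logGamma2 logGamma2' logGamma2'' 0 := by
  refine ⟨fun s hs => exp_logGamma2 hs, fun s hs => ?_, fun s hs => ?_, fun x hx => ?_⟩
  · have h0 : HasDerivAt (fun w : ℂ => w - 1) 1 s := (hasDerivAt_id s).sub_const 1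
    refine HasDerivAt.neg (HasDerivAt.add ?_ (summable_and_hasDerivAt_logGamma2Term hs).2)
    refine (((h0.pow 2).const_mul _).add (h0.const_mul _)).congr_deriv ?_
    push_cast
    ring
  · have h0 : HasDerivAt (fun w : ℂ => w - 1) 1 s := (hasDerivAt_id s).sub_const 1
    refine HasDerivAt.neg (HasDerivAt.add ?_ (summable_and_hasDerivAt_logGamma2Term' hs).2)
    refine (((h0.const_mul 2).const_mul _).add_const _).congr_deriv ?_
    ring
  · have h : ∀ k, (logGamma2Term k x).im = 0 := fun k => by
      have h1 : ((x : ℂ) - 1) = ((x - 1 : ℝ) : ℂ) := by push_cast; rfl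
      have h2 : ((x - 1 : ℝ) : ℂ) ^ 2 / (2 * ((k : ℂ) + 1)) =
        (((x - 1) ^ 2 / (2 * (k + 1)) : ℝ) : ℂ) := by push_cast; rfl
      have h3 := log_one_add_ofReal_im k hx
      rw [h1] at h3
      rw [logGamma2Term, h1, h2, add_im, sub_im, mul_im, h3, ofReal_im, ofReal_im]
      simp
    rw [logGamma2, neg_im, add_im, Complex.im_tsum (summable_and_hasDerivAt_logGamma2Term
      (by simpa using hx)).1]
    have hz : deriv riemannZeta 0 = ((deriv riemannZeta 0).re : ℂ) :=
      Complex.ext rfl (by rw [deriv_riemannZeta_zero_im, ofReal_im])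
    rw [hz]
    have h4 : ((-(1 / 2) - (Real.eulerMascheroniConstant : ℂ) / 2) * ((x : ℂ) - 1) ^ 2
      + (-(1 / 2) - ((deriv riemannZeta 0).re : ℂ)) * ((x : ℂ) - 1)) =
      (((-(1 / 2) - Real.eulerMascheroniConstant / 2) * (x - 1) ^ 2
      + (-(1 / 2) - (deriv riemannZeta 0).re) * (x - 1) : ℝ) : ℂ) := by push_cast; rfl
    rw [h4, ofReal_im]
    simp [h]

/-! ### Functional equations -/

theorem tendsto_natCast_div_natCast_add (w : ℂ) :
    Tendsto (fun n : ℕ => (n : ℂ) / (n + w)) atTop (𝓝 1) :=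
  tendsto_natCast_div_add_atTop w

/-- The partial sums on the two sides differ by those of the digamma series plus `n / (n + w) → 1`.
That limit and Euler's constant are absorbed by the increment of the quadratic term in the exponent
of `Γ₂`. -/
theorem logGamma2'_add_one {w : ℂ} (hw : 0 < w.re) :
    logGamma2' (w + 1) = logGamma2' w - digammaSeries w := by
  have hw1 : 0 < (w + 1).re := by simp; linarith
  have h1 := (summable_and_hasDerivAt_logGamma2Term' hw1).1.hasSum.tendsto_sum_nat
  have h2 := (summable_and_hasDerivAt_logGamma2Term' hw).1.hasSum.tendsto_sum_nat
  have h3 := (summable_and_hasDerivAt_digammaTerm hw).1.hasSum.tendsto_sum_nat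
  have key : ∀ n : ℕ, ∑ k ∈ Finset.range n,
      (((k : ℂ) + 1) / (k + (w + 1)) - 1 + ((w + 1) - 1) / (k + 1)) =
      ∑ k ∈ Finset.range n, (((k : ℂ) + 1) / (k + w) - 1 + (w - 1) / (k + 1)) +
      (n / (n + w) + ∑ k ∈ Finset.range n, (1 / ((k : ℂ) + 1) - 1 / (k + w))) := by
    intro n
    induction n with
    | zero => simp
    | succ n ih =>
      rw [Finset.sum_range_succ, Finset.sum_range_succ, Finset.sum_range_succ, ih]
      have hk : (n : ℂ) + 1 ≠ 0 := n.cast_add_one_ne_zero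
      have hkw := natCast_add_ne_zero n hw
      have hkw1 := natCast_add_ne_zero n hw1
      have hkw2 : (n : ℂ) + 1 + w ≠ 0 := by rwa [add_assoc, add_comm 1 w]
      push_cast
      rw [show (n : ℂ) + (w + 1) = n + 1 + w by ring]
      field_simp
      ring
  have h4 := tendsto_nhds_unique (h1.congr key)
    (h2.add ((tendsto_natCast_div_natCast_add w).add h3))
  rw [logGamma2', h4, logGamma2', digammaSeries]
  ring

/-- The logarithm of the quotient of the two sides has zero derivative. The value of the constant
does not matter, since `Γ₂` enters the ladder only through quotients. -/
theorem exists_Gamma2_add_one :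
    ∃ c : ℂ, c ≠ 0 ∧ ∀ w : ℂ, 0 < w.re →
      Gamma2 (w + 1) = c * (Gamma2 w * (Complex.Gamma w)⁻¹) := by
  have hre : ∀ {w : ℂ}, 0 < w.re → 0 < (w + 1).re := fun {w} hw => by simp; linarith
  have hd : ∀ w : ℂ, 0 < w.re →
      HasDerivAt (fun w => logGamma2 (w + 1) - logGamma2 w + logGamma w) 0 w := by
    intro w hw
    have h1 := (isRealLog_Gamma2.hasDerivAt _ (hre hw)).comp_add_const w 1
    refine ((h1.sub (isRealLog_Gamma2.hasDerivAt w hw)).add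
      (isRealLog_Gamma.hasDerivAt w hw)).congr_deriv ?_
    rw [logGamma2'_add_one hw]
    ring
  have hconst : ∀ w : ℂ, 0 < w.re → logGamma2 (w + 1) - logGamma2 w + logGamma w =
      logGamma2 (1 + 1) - logGamma2 1 + logGamma 1 := by
    intro w hw
    refine (convex_halfSpace_re_gt (0 : ℝ)).is_const_of_fderivWithin_eq_zero (𝕜 := ℂ)
      (f := fun w => logGamma2 (w + 1) - logGamma2 w + logGamma w)
      (fun z hz => (hd z hz).differentiableAt.differentiableWithinAt) (fun z hz => ?_) hw
      (by simp)
    rw [fderivWithin_of_isOpen (isOpen_lt continuous_const Complex.continuous_re) hz]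
    ext
    simpa using (hd z hz).deriv
  refine ⟨_, Complex.exp_ne_zero (logGamma2 (1 + 1) - logGamma2 1 + logGamma 1), fun w hw => ?_⟩
  rw [← hconst w hw, ← exp_logGamma2 (hre hw), ← exp_logGamma2 hw, ← exp_logGamma hw,
    ← Complex.exp_neg, ← Complex.exp_add, ← Complex.exp_add]
  congr 1
  ring

/-- The multiplication theorem for `Γ`, up to the value of the constant. -/
theorem exists_prod_Gamma (p : ℕ) (hp : 0 < p) :
    ∃ c : ℂ, c ≠ 0 ∧ ∀ z : ℂ, 0 < z.re →
      ∏ j ∈ Finset.range p, Complex.Gamma ((z + j) / p) =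
        c * (Complex.exp (-(z * Real.log p)) * Complex.Gamma z) := by
  have hp0 : (p : ℂ) ≠ 0 := Nat.cast_ne_zero.mpr hp.ne'
  have hnz : ∀ {z : ℂ} (m : ℕ), 0 < z.re → z + m ≠ 0 := fun m hz => by
    rw [add_comm]; exact natCast_add_ne_zero m hz
  have hprod : ∀ (z : ℂ) (n : ℕ), ∏ j ∈ Finset.range p, ∏ i ∈ Finset.range n, ((z + j) / p + i) =
      (∏ m ∈ Finset.range (n * p), (z + m)) / (p : ℂ) ^ (n * p) := by
    intro z n
    induction n with
    | zero => simp
    | succ n ih =>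
      simp only [Finset.prod_range_succ]
      rw [Finset.prod_mul_distrib, ih, Nat.succ_mul, Finset.prod_range_add, pow_add]
      have : ∀ j : ℕ, (z + j) / (p : ℂ) + n = (z + ((n * p + j : ℕ) : ℂ)) / p := by
        intro j; push_cast; field_simp; ring
      simp only [this]
      rw [Finset.prod_div_distrib, Finset.prod_const, Finset.card_range]
      field_simp
  -- Chosen so that the `N n + 1` linear factors of `GammaSeq z (N n)` are exactly the `(n + 1) * p`
  -- factors coming from the `p` sequences on the left.
  set N : ℕ → ℕ := fun n => (n + 1) * p - 1 with hN
  have hN1 : ∀ n, N n + 1 = (n + 1) * p := fun n => Nat.sub_add_cancel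
    (Nat.one_le_iff_ne_zero.mpr (Nat.mul_ne_zero n.succ_ne_zero hp.ne'))
  have hNtop : Tendsto N atTop atTop := by
    refine tendsto_atTop_mono (fun n => ?_) tendsto_id
    have := hN1 n
    simp only [id]
    nlinarith
  -- Collects everything independent of `z`; the remaining exponential tends to `p ^ (-z)`.
  set K : ℕ → ℂ := fun n => ((n.factorial : ℂ) ^ p * (p : ℂ) ^ ((n + 1) * p) / (N n).factorial) *
    Complex.exp ((∑ j ∈ Finset.range p, (j : ℂ) / p) * Real.log n) with hK
  have hseq : ∀ z : ℂ, 0 < z.re → ∀ᶠ n in atTop,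
      ∏ j ∈ Finset.range p, Complex.GammaSeq ((z + j) / p) n =
        K n * Complex.exp (z * (Real.log n - Real.log (N n))) * Complex.GammaSeq z (N n) := by
    intro z hz
    filter_upwards [eventually_gt_atTop 0, hNtop.eventually_gt_atTop 0] with n hn hNn
    have hn0 : (n : ℂ) ≠ 0 := Nat.cast_ne_zero.mpr hn.ne'
    have hN0 : (N n : ℂ) ≠ 0 := Nat.cast_ne_zero.mpr hNn.ne'
    have hpr : ∏ m ∈ Finset.range ((n + 1) * p), (z + m) ≠ 0 :=
      Finset.prod_ne_zero_iff.mpr fun m _ => hnz m hz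
    have hf : ((N n).factorial : ℂ) ≠ 0 := Nat.cast_ne_zero.mpr (Nat.factorial_ne_zero _)
    simp only [Complex.GammaSeq]
    rw [Finset.prod_div_distrib, hprod, Finset.prod_mul_distrib, Finset.prod_const,
      Finset.card_range, hN1, hK]
    have e1 : ∏ j ∈ Finset.range p, (n : ℂ) ^ ((z + j) / p) =
        Complex.exp (z * Real.log n) *
          Complex.exp ((∑ j ∈ Finset.range p, (j : ℂ) / p) * Real.log n) := by
      rw [← Complex.exp_add, ← add_mul]
      have : z + ∑ j ∈ Finset.range p, (j : ℂ) / p = ∑ j ∈ Finset.range p, (z + j) / p := by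
        simp only [add_div]
        rw [Finset.sum_add_distrib, Finset.sum_const, Finset.card_range, nsmul_eq_mul]
        field_simp
      rw [this, Finset.sum_mul, Complex.exp_sum]
      refine Finset.prod_congr rfl fun j _ => ?_
      rw [Complex.cpow_def_of_ne_zero hn0, ← Complex.natCast_log, mul_comm]
    have e2 : (N n : ℂ) ^ z = Complex.exp (z * Real.log (N n)) := by
      rw [Complex.cpow_def_of_ne_zero hN0, ← Complex.natCast_log, mul_comm]
    rw [e1, e2, mul_sub, Complex.exp_sub]
    have := Complex.exp_ne_zero (z * Real.log (N n))
    field_simp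
  have hlogs : Tendsto (fun n : ℕ => ((Real.log n - Real.log (N n) : ℝ) : ℂ)) atTop
      (𝓝 (-(Real.log p : ℂ))) := by
    have h1 : Tendsto (fun n : ℕ => (N n : ℝ) / n) atTop (𝓝 (p + (p - 1) * 0)) := by
      refine (tendsto_const_nhds.add (tendsto_one_div_atTop_nhds_zero_nat.const_mul
        ((p : ℝ) - 1))).congr' ?_
      filter_upwards [eventually_gt_atTop 0] with n hn
      have : (N n : ℝ) = (n + 1) * p - 1 := by
        have := congrArg (Nat.cast (R := ℝ)) (hN1 n)
        push_cast at this
        linarith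
      rw [this]
      have : (n : ℝ) ≠ 0 := Nat.cast_ne_zero.mpr hn.ne'
      field_simp
      ring
    rw [mul_zero, add_zero] at h1
    have h2 := (h1.log (Nat.cast_ne_zero.mpr hp.ne')).neg
    have h3 := (Complex.continuous_ofReal.tendsto _).comp h2
    rw [ofReal_neg] at h3
    refine h3.congr' ?_
    filter_upwards [eventually_gt_atTop 0, hNtop.eventually_gt_atTop 0] with n hn hNn
    simp only [Function.comp]
    rw [Real.log_div (Nat.cast_ne_zero.mpr hNn.ne') (Nat.cast_ne_zero.mpr hn.ne'), neg_sub]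
  -- One sequence `K` has a limit expressible through any `z`, so that expression is independent of
  -- `z` and may be evaluated at 1.
  have hlim : ∀ z : ℂ, 0 < z.re → Tendsto K atTop
      (𝓝 ((∏ j ∈ Finset.range p, Complex.Gamma ((z + j) / p)) /
        (Complex.exp (-(z * Real.log p)) * Complex.Gamma z))) := by
    intro z hz
    have h1 : Tendsto (fun n => ∏ j ∈ Finset.range p, Complex.GammaSeq ((z + j) / p) n) atTop
        (𝓝 (∏ j ∈ Finset.range p, Complex.Gamma ((z + j) / p))) :=
      tendsto_finsetProd _ fun j _ => Complex.GammaSeq_tendsto_Gamma _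
    have h2 := ((Complex.continuous_exp.tendsto _).comp (hlogs.const_mul z)).mul
      ((Complex.GammaSeq_tendsto_Gamma z).comp hNtop)
    rw [mul_neg] at h2
    refine (h1.div h2 (mul_ne_zero (Complex.exp_ne_zero _)
      (Complex.Gamma_ne_zero_of_re_pos hz))).congr' ?_
    filter_upwards [hseq z hz, hNtop.eventually_gt_atTop 0] with n hn hNn
    have hpr : ∏ m ∈ Finset.range (N n + 1), (z + m) ≠ 0 :=
      Finset.prod_ne_zero_iff.mpr fun m _ => hnz m hz
    have hG : Complex.GammaSeq z (N n) ≠ 0 := by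
      rw [Complex.GammaSeq]
      refine div_ne_zero (mul_ne_zero ?_ (Nat.cast_ne_zero.mpr (Nat.factorial_ne_zero _))) hpr
      rw [Complex.cpow_def_of_ne_zero (Nat.cast_ne_zero.mpr hNn.ne')]
      exact Complex.exp_ne_zero _
    simp only [Pi.div_apply, Function.comp, hn, ofReal_sub]
    rw [mul_assoc, mul_div_cancel_right₀ _ (mul_ne_zero (Complex.exp_ne_zero _) hG)]
  have h1 : (0 : ℝ) < (1 : ℂ).re := by simp
  refine ⟨(∏ j ∈ Finset.range p, Complex.Gamma ((1 + j) / p)) /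
    (Complex.exp (-(1 * Real.log p)) * Complex.Gamma 1), ?_, fun z hz => ?_⟩
  rotate_left
  · refine (div_eq_iff (mul_ne_zero (Complex.exp_ne_zero _)
      (Complex.Gamma_ne_zero_of_re_pos hz))).mp (tendsto_nhds_unique (hlim z hz) (hlim 1 h1))
  · refine div_ne_zero (Finset.prod_ne_zero_iff.mpr fun j _ =>
      Complex.Gamma_ne_zero_of_re_pos ?_) (mul_ne_zero (Complex.exp_ne_zero _)
      (Complex.Gamma_ne_zero_of_re_pos h1))
    have h : (((1 : ℂ) + j) / p) = (((1 + j) / p : ℝ) : ℂ) := by push_cast; rfl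
    rw [h, ofReal_re]
    positivity

/-- The quotient of two instances of the multiplication theorem. -/
theorem prod_Gamma_div (p : ℕ) (hp : 0 < p) (z : ℂ) (hz : 0 < z.re) (δ : ℝ) (hδ : 0 ≤ δ) :
    Complex.exp (δ * Real.log p) * ∏ j ∈ Finset.range p,
      (Complex.Gamma ((z + j) / p))⁻¹ * Complex.Gamma ((z + δ + j) / p) =
      (Complex.Gamma z)⁻¹ * Complex.Gamma (z + δ) := by
  obtain ⟨c, hc, h⟩ := exists_prod_Gamma p hp
  have hz' : 0 < (z + δ).re := by simp; linarith
  have hG := Complex.Gamma_ne_zero_of_re_pos hz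
  rw [Finset.prod_mul_distrib, Finset.prod_inv_distrib, h z hz, h (z + δ) hz', add_mul, neg_add,
    Complex.exp_add, Complex.exp_neg (δ * _)]
  have h1 := Complex.exp_ne_zero (-(z * (Real.log p : ℂ)))
  have h2 := Complex.exp_ne_zero ((δ : ℂ) * (Real.log p : ℂ))
  field_simp

/-! ### Behaviour far to the right -/

theorem tendsto_norm_natCast_add_comap_re (k : ℕ) (c : ℝ) :
    Tendsto (fun w : ℂ => ‖(k : ℂ) + (w + c)‖) (comap Complex.re atTop) atTop := by
  have h : Tendsto (fun w : ℂ => (k : ℝ) + c + w.re) (comap Complex.re atTop) atTop :=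
    tendsto_atTop_add_const_left _ _ tendsto_comap
  refine tendsto_atTop_mono (fun w => ?_) h
  refine le_trans (le_of_eq ?_) (natCast_add_re_le_norm k (w + c))
  simp; ring

theorem tendsto_trigamma : Tendsto trigamma (comap Complex.re atTop) (𝓝 0) := by
  have h0 : (0 : ℂ) = ∑' _ : ℕ, (0 : ℂ) := tsum_zero.symm
  rw [h0]
  refine tendsto_tsum_of_dominated_convergence (bound := fun k : ℕ => 1 / ((k : ℝ) + 1) ^ 2)
    (summable_div_succ_sq 1) (fun k => ?_) ?_
  · have h := tendsto_norm_natCast_add_comap_re k 0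
    simp only [ofReal_zero, add_zero] at h
    rw [tendsto_zero_iff_norm_tendsto_zero]
    simp only [one_div, norm_inv, norm_pow]
    exact ((tendsto_pow_atTop two_ne_zero).comp h).inv_tendsto_atTop
  · filter_upwards [preimage_mem_comap (Ici_mem_atTop (1 : ℝ))] with w hw k
    simpa using norm_one_div_sq_le k one_pos le_rfl hw

theorem summable_logGamma2''Term {w : ℂ} (hw : 0 < w.re) :
    Summable fun k : ℕ => (1 / ((k : ℂ) + 1) - ((k : ℂ) + 1) / (k + w) ^ 2) := by
  obtain ⟨ε, hε0, hε⟩ := exists_between (lt_min hw one_pos)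
  obtain ⟨hεw, hε1⟩ := lt_min_iff.mp hε
  exact Summable.of_norm_bounded (summable_div_succ_sq _)
    fun k => norm_logGamma2Term''_le k hε0 hε1.le hεw.le le_rfl

/-- A single `logGamma2''` grows logarithmically; the divergent part cancels in the difference of
two translates. -/
theorem tendsto_logGamma2''_sub (δ : ℝ) (hδ : 0 ≤ δ) :
    Tendsto (fun w => logGamma2'' (w + δ) - logGamma2'' w) (comap Complex.re atTop) (𝓝 0) := by
  have hev : ∀ᶠ w : ℂ in comap Complex.re atTop, 1 ≤ w.re :=
    preimage_mem_comap (Ici_mem_atTop (1 : ℝ))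
  have h1 : Tendsto (fun w : ℂ => ∑' k : ℕ,
      (((k : ℂ) + 1) / (k + (w + δ)) ^ 2 - ((k : ℂ) + 1) / (k + w) ^ 2))
      (comap Complex.re atTop) (𝓝 (∑' _ : ℕ, (0 : ℂ))) := by
    refine tendsto_tsum_of_dominated_convergence
      (bound := fun k : ℕ => 2 * δ / ((k : ℝ) + 1) ^ 2)
      (summable_div_succ_sq _) (fun k => ?_) ?_
    · have h : ∀ c : ℝ, Tendsto (fun w : ℂ => ((k : ℂ) + 1) / (k + (w + c)) ^ 2)
          (comap Complex.re atTop) (𝓝 0) := by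
        intro c
        rw [tendsto_zero_iff_norm_tendsto_zero]
        simp only [norm_div, norm_pow]
        exact ((tendsto_pow_atTop two_ne_zero).comp
          (tendsto_norm_natCast_add_comap_re k c)).const_div_atTop _
      simpa using (h δ).sub (h 0)
    · filter_upwards [hev] with w hw k
      have hw0 : 0 < w.re := by linarith
      have hδre : 1 ≤ (w + δ).re := by simp; linarith
      have hA := natCast_add_ne_zero k hw0
      have hB := natCast_add_ne_zero k (w := w + δ) (by linarith)
      have hAn := mul_succ_le_norm_natCast_add k le_rfl hw
      have hBn := mul_succ_le_norm_natCast_add k le_rfl hδre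
      rw [one_mul] at hAn hBn
      -- Factoring out `δ` leaves three denominator factors against one `k + 1`, hence a summable
      -- bound uniform in `w`.
      have e : ((k : ℂ) + 1) / (k + (w + δ)) ^ 2 - ((k : ℂ) + 1) / (k + w) ^ 2 =
          -(((k : ℂ) + 1) * δ * (1 / ((k + w) * (k + (w + δ)) ^ 2) +
            1 / ((k + w) ^ 2 * (k + (w + δ))))) := by
        field_simp
        ring
      have h2 : ‖(k : ℂ) + 1‖ = k + 1 := by
        rw [← Nat.cast_add_one, Complex.norm_natCast]; push_cast; rfl
      have hk : (0 : ℝ) < k + 1 := by positivity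
      rw [e, norm_neg, norm_mul, norm_mul, h2, Complex.norm_real, Real.norm_of_nonneg hδ]
      have h3 : ‖1 / (((k : ℂ) + w) * (k + (w + δ)) ^ 2)‖ ≤ 1 / ((k + 1) * ((k : ℝ) + 1) ^ 2) := by
        rw [norm_div, norm_one, norm_mul, norm_pow]; gcongr
      have h4 : ‖1 / (((k : ℂ) + w) ^ 2 * (k + (w + δ)))‖ ≤
          1 / (((k : ℝ) + 1) ^ 2 * (k + 1)) := by
        rw [norm_div, norm_one, norm_mul, norm_pow]; gcongr
      calc ((k : ℝ) + 1) * δ * ‖_‖ ≤ (k + 1) * δ * (1 / ((k + 1) * ((k : ℝ) + 1) ^ 2) +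
            1 / (((k : ℝ) + 1) ^ 2 * (k + 1))) := by
              gcongr; exact (norm_add_le _ _).trans (add_le_add h3 h4)
        _ = 2 * δ / ((k : ℝ) + 1) ^ 2 := by field_simp; ring
  rw [tsum_zero] at h1
  refine h1.congr' ?_
  filter_upwards [hev] with w hw
  have hw0 : 0 < w.re := by linarith
  have hδre : 0 < (w + δ).re := by simp; linarith
  rw [logGamma2'', logGamma2'', neg_sub_neg, add_sub_add_left_eq_sub,
    ← (summable_logGamma2''Term hw0).tsum_sub (summable_logGamma2''Term hδre)]
  exact tsum_congr fun k => by ring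

/-- `f` has a real logarithm on `Re s > a` whose second derivative vanishes at infinity. -/
def HasRealLog (f : ℂ → ℂ) (a : ℝ) : Prop :=
  ∃ L L' L'' : ℂ → ℂ, IsRealLog f L L' L'' a ∧ Tendsto L'' (comap Complex.re atTop) (𝓝 0)

theorem tendsto_affine_comap_re (c d : ℝ) (hd : 0 < d) :
    Tendsto (fun s : ℂ => (s + c) / d) (comap Complex.re atTop) (comap Complex.re atTop) := by
  rw [tendsto_comap_iff]
  have h : Tendsto (fun s : ℂ => (s.re + c) / d) (comap Complex.re atTop) atTop :=
    (tendsto_atTop_add_const_right _ c tendsto_comap).atTop_div_const hd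
  refine h.congr fun s => ?_
  simp [Complex.div_ofReal_re]

namespace HasRealLog

variable {f g : ℂ → ℂ} {a : ℝ}

theorem congr (h : HasRealLog f a) (hfg : ∀ s : ℂ, a < s.re → f s = g s) : HasRealLog g a := by
  obtain ⟨L, L', L'', h1, h2⟩ := h
  exact ⟨L, L', L'', h1.congr hfg, h2⟩

theorem mul (hf : HasRealLog f a) (hg : HasRealLog g a) : HasRealLog (fun s => f s * g s) a := by
  obtain ⟨L, L', L'', h1, h2⟩ := hf
  obtain ⟨M, M', M'', h3, h4⟩ := hg
  exact ⟨_, _, _, h1.mul h3, by simpa using h2.add h4⟩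

theorem inv (hf : HasRealLog f a) : HasRealLog (fun s => (f s)⁻¹) a := by
  obtain ⟨L, L', L'', h1, h2⟩ := hf
  exact ⟨_, _, _, h1.inv, by simpa using h2.neg⟩

theorem zpow (hf : HasRealLog f a) (n : ℤ) : HasRealLog (fun s => f s ^ n) a := by
  obtain ⟨L, L', L'', h1, h2⟩ := hf
  exact ⟨_, _, _, h1.zpow n, by simpa using h2.const_mul (n : ℂ)⟩

theorem prod {ι : Type*} (t : Finset ι) {f : ι → ℂ → ℂ} (h : ∀ i, HasRealLog (f i) a) :
    HasRealLog (fun s => ∏ i ∈ t, f i s) a := by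
  choose L L' L'' h1 h2 using h
  exact ⟨_, _, _, IsRealLog.prod t fun i _ => h1 i,
    by simpa using tendsto_finsetSum t fun i _ => h2 i⟩

theorem exp_mul (c : ℝ) (a : ℝ) : HasRealLog (fun s => Complex.exp (s * c)) a :=
  ⟨_, _, _, IsRealLog.exp_mul c a, tendsto_const_nhds⟩

theorem Gamma_affine (c d : ℝ) (hd : 0 < d) (ha : -c ≤ a) :
    HasRealLog (fun s => Complex.Gamma ((s + c) / d)) a := by
  refine ⟨_, _, _, isRealLog_Gamma.comp_affine c d hd (by simpa using ha), ?_⟩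
  simpa using ((tendsto_trigamma.comp (tendsto_affine_comap_re c d hd)).const_mul
    ((d : ℂ)⁻¹)).const_mul ((d : ℂ)⁻¹)

/-- `Γ₂` is admitted only in quotients, for which the second derivative of the logarithm decays. -/
theorem Gamma2_div_affine (c δ d : ℝ) (hδ : 0 ≤ δ) (hd : 0 < d) (ha : -c ≤ a) :
    HasRealLog (fun s => Gamma2 ((s + c) / d) * (Gamma2 ((s + (c + δ)) / d))⁻¹) a := by
  have h1 := (isRealLog_Gamma2.comp_affine (b := a) c d hd (by simpa using ha))
  have h2 := (isRealLog_Gamma2.comp_affine (b := a) (c + δ) d hd (by linarith)).inv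
  refine ⟨_, _, _, (h1.mul h2).congr fun s _ => by push_cast; rfl, ?_⟩
  have h3 := ((((tendsto_logGamma2''_sub (δ / d) (by positivity)).comp
    (tendsto_affine_comap_re c d hd)).const_mul ((d : ℂ)⁻¹)).const_mul ((d : ℂ)⁻¹)).neg
  simp only [mul_zero, neg_zero] at h3
  refine h3.congr fun s => ?_
  simp only [Function.comp]
  rw [show (s + ((c + δ : ℝ) : ℂ)) / d = (s + c) / d + ((δ / d : ℝ) : ℂ) by push_cast; ring]
  ring

end HasRealLog

/-! ### The functions `E2`, `E3` and `G_l`. -/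

theorem hasRealLog_E2 : HasRealLog E2 0 := by
  refine ((HasRealLog.Gamma_affine 0 2 two_pos (by simp)).inv.mul
    (HasRealLog.Gamma_affine 1 2 two_pos (by simp))).congr fun s _ => ?_
  simp [E2]

theorem hasRealLog_E3 : HasRealLog E3 0 := by
  refine ((HasRealLog.Gamma_affine 0 3 three_pos (by simp)).inv.mul
    (HasRealLog.Gamma_affine 2 3 three_pos (by simp))).congr fun s _ => ?_
  simp [E3]

theorem prod_range_two_mul (f : ℕ → ℂ) (n : ℕ) :
    ∏ r ∈ Finset.range (2 * n), f r = ∏ j ∈ Finset.range n, f (2 * j) * f (2 * j + 1) := by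
  induction n with
  | zero => simp
  | succ n ih =>
    rw [mul_add, mul_one, Finset.prod_range_succ, Finset.prod_range_succ, ih,
      Finset.prod_range_succ, mul_assoc]

theorem G_of_odd {l : ℕ} (hl : l % 2 = 1) (s : ℂ) :
    G l s = Complex.exp (s / (2 * l) * (Real.log l : ℂ)) *
      ∏ r ∈ Finset.range l, Complex.Gamma ((s + l + r) / (2 * l)) ^ ((-1 : ℤ) ^ r) := by
  rw [G, if_pos hl]

/-- Pairing consecutive alternating factors exhibits the quotients of `Γ₂` required by
`Gamma2_div_affine`. -/
theorem G_two_mul (p : ℕ) (s : ℂ) :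
    G (2 * p) s = Complex.exp (s / (2 * (2 * p : ℕ)) * (Real.log p : ℂ)) *
      ∏ j ∈ Finset.range p, Gamma2 ((s + ((2 * p : ℕ) + 2 * j)) / (2 * p : ℕ)) *
        (Gamma2 ((s + ((2 * p : ℕ) + 2 * j + 1)) / (2 * p : ℕ)))⁻¹ := by
  rw [G, if_neg (by lia), prod_range_two_mul]
  congr 3
  · push_cast
    rw [mul_div_cancel_left₀ _ two_ne_zero, Complex.natCast_log]
  · ext j
    rw [pow_mul, pow_add, pow_mul]
    simp [add_assoc]

theorem hasRealLog_G {l : ℕ} (hl : 1 ≤ l) : HasRealLog (G l) (-l) := by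
  have hl0 : (0 : ℝ) < l := by positivity
  rcases Nat.even_or_odd' l with ⟨p, rfl | rfl⟩
  · refine ((HasRealLog.exp_mul (Real.log p / (2 * (2 * p : ℕ))) _).mul
      (HasRealLog.prod (Finset.range p) fun j => HasRealLog.Gamma2_div_affine
        ((2 * p : ℕ) + 2 * j) 1 (2 * p : ℕ) zero_le_one hl0 ?_)).congr fun s _ => ?_
    · have : (0 : ℝ) ≤ j := j.cast_nonneg
      linarith
    · rw [G_two_mul]
      congr 2
      · push_cast; ring
      · ext j; push_cast; rfl
  · set l := 2 * p + 1 with hlp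
    refine ((HasRealLog.exp_mul (Real.log l / (2 * l)) _).mul
      (HasRealLog.prod (Finset.range l) fun r => (HasRealLog.Gamma_affine
        (l + r) (2 * l) (by positivity) ?_).zpow ((-1) ^ r))).congr fun s _ => ?_
    · have : (0 : ℝ) ≤ r := r.cast_nonneg
      linarith
    · rw [G_of_odd (by lia)]
      congr 2
      · push_cast; ring
      · ext r; push_cast; rw [add_assoc]

theorem exp_add_shift (s : ℂ) {l : ℕ} (hl : 1 ≤ l) (δ c : ℂ) :
    Complex.exp (δ * (s + l) / l * c) = Complex.exp (δ * s / l * c) * Complex.exp (δ * c) := by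
  have : (l : ℂ) ≠ 0 := Nat.cast_ne_zero.mpr (by lia)
  rw [← Complex.exp_add]
  congr 1
  field_simp

/-- The ladder relation of `G_l`. -/
theorem G_add {l : ℕ} (hl : 1 ≤ l) {s : ℂ} (hs : -(l : ℝ) < s.re) :
    G l (s + l) = G l s * E2 (s + l) := by
  have hu : 0 < (s + l).re := by simp; linarith
  have hu2 : 0 < ((s + l) / 2).re := by
    rw [show (2 : ℂ) = ((2 : ℝ) : ℂ) by push_cast; rfl, Complex.div_ofReal_re]; positivity
  -- The multiplication theorem at `(s + l) / 2` with shift `1 / 2`. It is used with `p = l / 2` for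
  -- even `l` and `p = l` for odd `l`, which accounts for the logarithm in the exponential factor of
  -- `G_l`.
  have hE : ∀ p : ℕ, 0 < p → Complex.exp (1 / 2 * Real.log p) * ∏ j ∈ Finset.range p,
      (Complex.Gamma (((s + l) / 2 + j) / p))⁻¹ * Complex.Gamma (((s + l) / 2 + 1 / 2 + j) / p) =
      E2 (s + l) := by
    intro p hp
    have h := prod_Gamma_div p hp _ hu2 (1 / 2) (by norm_num)
    simp only [ofReal_div, ofReal_one, ofReal_ofNat] at h
    rw [h, E2, add_div (s + (l : ℂ))]
  have hl0 : (0 : ℝ) < l := by positivity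
  have hlC : (l : ℂ) ≠ 0 := Nat.cast_ne_zero.mpr (by lia)
  have hexp : ∀ (t : ℂ) (c : ℂ), t / (2 * l) * c = 1 / 2 * t / l * c := fun t c => by
    field_simp
  rcases Nat.even_or_odd' l with ⟨p, hp | hp⟩
  · have hp0 : 0 < p := by lia
    have hpC : (p : ℂ) ≠ 0 := Nat.cast_ne_zero.mpr hp0.ne'
    obtain ⟨c, hc, hΓ⟩ := exists_Gamma2_add_one
    have hpos : ∀ m : ℕ, 0 < ((s + l + m) / l).re := fun m => by
      rw [← Complex.ofReal_natCast l, Complex.div_ofReal_re, add_re, natCast_re]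
      have : (0 : ℝ) ≤ m := m.cast_nonneg
      rw [ofReal_natCast]
      positivity
    -- Translating `s` by `l` raises the argument of `Γ₂` by 1; the constant `c` then cancels within
    -- each pair.
    have hstep : ∀ m : ℕ, Gamma2 ((s + l + l + m) / l) =
        c * (Gamma2 ((s + l + m) / l) * (Complex.Gamma ((s + l + m) / l))⁻¹) := fun m => by
      rw [← hΓ _ (hpos m)]
      congr 1
      field_simp
      ring
    have hsG : ∀ t : ℂ, G l t = Complex.exp (1 / 2 * t / l * Real.log p) *
        ∏ j ∈ Finset.range p, Gamma2 ((t + l + (2 * j : ℕ)) / l) *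
          (Gamma2 ((t + l + (2 * j + 1 : ℕ)) / l))⁻¹ := fun t => by
      rw [← hexp]
      subst hp
      rw [G_two_mul]
      congr 2
      ext j
      push_cast
      ring_nf
    rw [hsG (s + l), hsG s, exp_add_shift s hl, ← hE p hp0]
    have hprod : ∏ j ∈ Finset.range p, Gamma2 ((s + l + l + (2 * j : ℕ)) / l) *
          (Gamma2 ((s + l + l + (2 * j + 1 : ℕ)) / l))⁻¹ =
        (∏ j ∈ Finset.range p, Gamma2 ((s + l + (2 * j : ℕ)) / l) *
          (Gamma2 ((s + l + (2 * j + 1 : ℕ)) / l))⁻¹) *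
        ∏ j ∈ Finset.range p, (Complex.Gamma (((s + l) / 2 + j) / p))⁻¹ *
          Complex.Gamma (((s + l) / 2 + 1 / 2 + j) / p) := by
      rw [← Finset.prod_mul_distrib]
      refine Finset.prod_congr rfl fun j _ => ?_
      have e1 : ((s + l) / 2 + j) / p = (s + l + (2 * j : ℕ)) / l := by
        subst hp; push_cast; field_simp
      have e2 : ((s + l) / 2 + 1 / 2 + j) / p = (s + l + (2 * j + 1 : ℕ)) / l := by
        subst hp; push_cast; field_simp; ring
      rw [hstep, hstep, e1, e2, mul_inv, mul_inv, inv_inv]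
      field_simp
    rw [hprod]
    ring
  · set f : ℕ → ℂ := fun r => Complex.Gamma ((s + l + r) / (2 * l)) with hf
    have hf0 : ∀ r, f r ≠ 0 := fun r => by
      refine Complex.Gamma_ne_zero_of_re_pos ?_
      rw [show (2 * l : ℂ) = ((2 * l : ℝ) : ℂ) by push_cast; rfl, Complex.div_ofReal_re, add_re,
        natCast_re]
      have : (0 : ℝ) ≤ r := r.cast_nonneg
      positivity
    -- The `2 * l` factors, ordered by numerator, alternate in exponent. Cutting at `l`, which is
    -- odd, reverses the signs in the second half, so the halves are `G_l(s)⁻¹` and `G_l(s + l)` up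
    -- to exponentials.
    have hall : ∏ j ∈ Finset.range l, (Complex.Gamma (((s + l) / 2 + j) / l))⁻¹ *
          Complex.Gamma (((s + l) / 2 + 1 / 2 + j) / l) =
        (∏ r ∈ Finset.range l, f r ^ ((-1 : ℤ) ^ r))⁻¹ *
          ∏ r ∈ Finset.range l, f (l + r) ^ ((-1 : ℤ) ^ r) := by
      have h1 := prod_range_two_mul (fun r => f r ^ (-(-1 : ℤ) ^ r)) l
      rw [two_mul, Finset.prod_range_add] at h1
      rw [← Finset.prod_inv_distrib]
      calc _ = ∏ j ∈ Finset.range l, f (2 * j) ^ (-(-1 : ℤ) ^ (2 * j)) *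
            f (2 * j + 1) ^ (-(-1 : ℤ) ^ (2 * j + 1)) := by
            refine Finset.prod_congr rfl fun j _ => ?_
            have e1 : ((s + l) / 2 + j) / l = (s + l + (2 * j : ℕ)) / (2 * l) := by
              push_cast; field_simp
            have e2 : ((s + l) / 2 + 1 / 2 + j) / l = (s + l + (2 * j + 1 : ℕ)) / (2 * l) := by
              push_cast; field_simp; ring
            rw [pow_add, pow_mul, e1, e2]
            simp only [hf, even_two, Even.neg_pow, one_pow, Int.reduceNeg, zpow_neg, zpow_one, pow_one,
              mul_neg, mul_one, neg_neg]
        _ = _ := by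
            rw [← h1]
            congr 1
            · exact Finset.prod_congr rfl fun r _ => by rw [zpow_neg]
            · refine Finset.prod_congr rfl fun r _ => ?_
              rw [pow_add, Odd.neg_one_pow ⟨p, hp⟩]
              simp
    have h0 : ∏ r ∈ Finset.range l, f r ^ ((-1 : ℤ) ^ r) ≠ 0 :=
      Finset.prod_ne_zero_iff.mpr fun r _ => zpow_ne_zero _ (hf0 r)
    rw [G_of_odd (by lia), G_of_odd (by lia), ← hE l (by lia), hall, hexp, hexp,
      exp_add_shift s hl]
    have h2 : ∏ r ∈ Finset.range l, Complex.Gamma ((s + l + l + r) / (2 * l)) ^ ((-1 : ℤ) ^ r) =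
        ∏ r ∈ Finset.range l, f (l + r) ^ ((-1 : ℤ) ^ r) :=
      Finset.prod_congr rfl fun r _ => by simp only [hf]; push_cast; rw [add_assoc (s + (l : ℂ))]
    rw [h2]
    change _ = _ * (∏ r ∈ Finset.range l, f r ^ ((-1 : ℤ) ^ r)) * _
    field_simp

/-! ### The functions `H_l` -/

theorem hasRealLog_H {l : ℕ} (hl : 1 ≤ l) : HasRealLog (H l) (-l) := by
  have hl0 : (0 : ℝ) < l := by positivity
  have hΓ : ∀ m : ℕ, l ≤ m → HasRealLog (fun s => Complex.Gamma ((s + m) / (3 * l))) (-l) := by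
    intro m hm
    refine (HasRealLog.Gamma_affine m (3 * l) (by positivity) ?_).congr fun s _ => ?_
    · have : (l : ℝ) ≤ m := Nat.cast_le.mpr hm
      linarith
    · push_cast; rfl
  have hexp : ∀ c : ℝ, HasRealLog (fun s => Complex.exp (2 * s / (3 * l) * c)) (-l) := fun c =>
    (HasRealLog.exp_mul (2 / (3 * l) * c) _).congr fun s _ => by
      congr 1; push_cast; ring
  by_cases h1 : l % 3 = 1
  · refine (((hexp (Real.log l)).mul (HasRealLog.prod (Finset.range (l / 3 + 1)) fun r =>
      (hΓ (l + 3 * r) (by lia)).mul (hΓ (2 * l + 3 * r) (by lia)))).mul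
      (HasRealLog.prod (Finset.range (l / 3)) fun r =>
      (hΓ (l + 3 * r + 2) (by lia)).inv.mul (hΓ (2 * l + 3 * r + 1) (by lia)).inv)).congr
      fun s _ => ?_
    rw [H, if_pos h1]
    push_cast
    simp only [add_assoc]
  by_cases h2 : l % 3 = 2
  · refine (((hexp (Real.log l)).mul (HasRealLog.prod (Finset.range (l / 3 + 1)) fun r =>
      (hΓ (l + 3 * r) (by lia)).mul (hΓ (2 * l + 3 * r + 1) (by lia)))).mul
      (HasRealLog.prod (Finset.range (l / 3)) fun r =>
      (hΓ (l + 3 * r + 2) (by lia)).inv.mul (hΓ (2 * l + 3 * r + 2) (by lia)).inv)).congr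
      fun s _ => ?_
    rw [H, if_neg h1, if_pos h2]
    push_cast
    simp only [add_assoc]
  · refine ((hexp (Real.log ((l : ℝ) / 3))).mul (HasRealLog.prod (Finset.range (l / 3)) fun r =>
      HasRealLog.Gamma2_div_affine (l + 3 * r) 2 l zero_le_two hl0 ?_)).congr fun s _ => ?_
    · have : (0 : ℝ) ≤ r := r.cast_nonneg
      linarith
    · rw [H, if_neg h1, if_neg h2]
      push_cast
      simp only [add_assoc]

/-- The ladder relation of `H_l`. -/
theorem H_add {l : ℕ} (hl : 1 ≤ l) {s : ℂ} (hs : -(l : ℝ) < s.re) :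
    H l (s + l) = H l s * E3 (s + l) := by
  have hu : 0 < (s + l).re := by simp; linarith
  have hu2 : 0 < ((s + l) / 3).re := by
    rw [show (3 : ℂ) = ((3 : ℝ) : ℂ) by push_cast; rfl, Complex.div_ofReal_re]; positivity
  -- The multiplication theorem at `(s + l) / 3` with shift `2 / 3`, used with `p = l` or, if 3
  -- divides `l`, with `p = l / 3`.
  have hE : ∀ p : ℕ, 0 < p → Complex.exp (2 / 3 * Real.log p) * ∏ j ∈ Finset.range p,
      (Complex.Gamma (((s + l) / 3 + j) / p))⁻¹ * Complex.Gamma (((s + l) / 3 + 2 / 3 + j) / p) =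
      E3 (s + l) := by
    intro p hp
    have h := prod_Gamma_div p hp _ hu2 (2 / 3) (by norm_num)
    simp only [ofReal_div, ofReal_ofNat] at h
    rw [h, E3, add_div (s + (l : ℂ))]
  have hl0 : (0 : ℝ) < l := by positivity
  have hlC : (l : ℂ) ≠ 0 := Nat.cast_ne_zero.mpr (by lia)
  have hexp : ∀ (t : ℂ) (c : ℂ), 2 * t / (3 * l) * c = 2 / 3 * t / l * c := fun t c => by
    field_simp
  set g : ℕ → ℂ := fun m => Complex.Gamma ((s + l + m) / (3 * l)) with hg
  have hg0 : ∀ m, g m ≠ 0 := fun m => by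
    refine Complex.Gamma_ne_zero_of_re_pos ?_
    rw [show (3 * l : ℂ) = ((3 * l : ℝ) : ℂ) by push_cast; rfl, Complex.div_ofReal_re, add_re,
      natCast_re]
    have : (0 : ℝ) ≤ m := m.cast_nonneg
    positivity
  have hP0 : ∀ (n : ℕ) (k : ℕ → ℕ), ∏ r ∈ Finset.range n, g (k r) ≠ 0 := fun n k =>
    Finset.prod_ne_zero_iff.mpr fun r _ => hg0 _
  have hEl := hE l hl
  have hall : ∏ j ∈ Finset.range l, (Complex.Gamma (((s + l) / 3 + j) / l))⁻¹ *
        Complex.Gamma (((s + l) / 3 + 2 / 3 + j) / l) =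
      (∏ j ∈ Finset.range l, g (3 * j))⁻¹ * ∏ j ∈ Finset.range l, g (3 * j + 2) := by
    rw [← Finset.prod_inv_distrib, ← Finset.prod_mul_distrib]
    refine Finset.prod_congr rfl fun j _ => ?_
    have e1 : ((s + l) / 3 + j) / l = (s + l + (3 * j : ℕ)) / (3 * l) := by
      push_cast; field_simp
    have e2 : ((s + l) / 3 + 2 / 3 + j) / l = (s + l + (3 * j + 2 : ℕ)) / (3 * l) := by
      push_cast; field_simp; ring
    rw [e1, e2]
  rw [hall] at hEl
  by_cases h1 : l % 3 = 1
  · obtain ⟨q, hq⟩ : ∃ q, l = 3 * q + 1 := ⟨l / 3, by lia⟩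
    have hq3 : l / 3 = q := by lia
    have hH : H l s = Complex.exp (2 / 3 * s / l * Real.log l) *
        ((∏ r ∈ Finset.range (q + 1), g (3 * r)) * ∏ r ∈ Finset.range (q + 1), g (l + 3 * r)) *
        ((∏ r ∈ Finset.range q, g (3 * r + 2))⁻¹ * (∏ r ∈ Finset.range q, g (l + 3 * r + 1))⁻¹) := by
      rw [H, if_pos h1, hq3, hexp, Finset.prod_mul_distrib, Finset.prod_mul_distrib,
        Finset.prod_inv_distrib, Finset.prod_inv_distrib]
      simp only [hg]
      push_cast
      ring_nf
    have hH' : H l (s + l) = Complex.exp (2 / 3 * (s + l) / l * Real.log l) *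
        ((∏ r ∈ Finset.range (q + 1), g (l + 3 * r)) *
          ∏ r ∈ Finset.range (q + 1), g (2 * l + 3 * r)) *
        ((∏ r ∈ Finset.range q, g (l + 3 * r + 2))⁻¹ *
          (∏ r ∈ Finset.range q, g (2 * l + 3 * r + 1))⁻¹) := by
      rw [H, if_pos h1, hq3, hexp, Finset.prod_mul_distrib, Finset.prod_mul_distrib,
        Finset.prod_inv_distrib, Finset.prod_inv_distrib]
      simp only [hg]
      push_cast
      ring_nf
    -- The multiples of 3 below `3 * l` are sorted into `[0, l)`, `[l, 2l)` and `[2l, 3l)`; as `l ≡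
    -- 1`, their offsets within these blocks are `0, 2, 1` modulo 3.
    have hn1 : ∏ j ∈ Finset.range l, g (3 * j) = (∏ r ∈ Finset.range (q + 1), g (3 * r)) *
        (∏ r ∈ Finset.range q, g (l + 3 * r + 2)) * ∏ r ∈ Finset.range q, g (2 * l + 3 * r + 1) := by
      rw [show Finset.range l = Finset.range (q + 1 + q + q) by congr 1; lia,
        Finset.prod_range_add, Finset.prod_range_add]
      congr 1
      · congr 1
        exact Finset.prod_congr rfl fun r _ => congrArg g (by lia)
      · exact Finset.prod_congr rfl fun r _ => congrArg g (by lia)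
    have hn2 : ∏ j ∈ Finset.range l, g (3 * j + 2) = (∏ r ∈ Finset.range q, g (3 * r + 2)) *
        (∏ r ∈ Finset.range q, g (l + 3 * r + 1)) * ∏ r ∈ Finset.range (q + 1), g (2 * l + 3 * r) := by
      rw [show Finset.range l = Finset.range (q + q + (q + 1)) by congr 1; lia,
        Finset.prod_range_add, Finset.prod_range_add]
      congr 1
      · congr 1
        exact Finset.prod_congr rfl fun r _ => congrArg g (by lia)
      · exact Finset.prod_congr rfl fun r _ => congrArg g (by lia)
    rw [hH', hH, ← hEl, hn1, hn2, exp_add_shift s hl]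
    have := hP0 (q + 1) fun r => 3 * r
    have := hP0 q fun r => l + 3 * r + 2
    have := hP0 q fun r => 2 * l + 3 * r + 1
    have := hP0 q fun r => 3 * r + 2
    have := hP0 q fun r => l + 3 * r + 1
    field_simp
  by_cases h2 : l % 3 = 2
  · obtain ⟨q, hq⟩ : ∃ q, l = 3 * q + 2 := ⟨l / 3, by lia⟩
    have hq3 : l / 3 = q := by lia
    have hH : H l s = Complex.exp (2 / 3 * s / l * Real.log l) *
        ((∏ r ∈ Finset.range (q + 1), g (3 * r)) *
          ∏ r ∈ Finset.range (q + 1), g (l + 3 * r + 1)) *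
        ((∏ r ∈ Finset.range q, g (3 * r + 2))⁻¹ * (∏ r ∈ Finset.range q, g (l + 3 * r + 2))⁻¹) := by
      rw [H, if_neg h1, if_pos h2, hq3, hexp, Finset.prod_mul_distrib, Finset.prod_mul_distrib,
        Finset.prod_inv_distrib, Finset.prod_inv_distrib]
      simp only [hg]
      push_cast
      ring_nf
    have hH' : H l (s + l) = Complex.exp (2 / 3 * (s + l) / l * Real.log l) *
        ((∏ r ∈ Finset.range (q + 1), g (l + 3 * r)) *
          ∏ r ∈ Finset.range (q + 1), g (2 * l + 3 * r + 1)) *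
        ((∏ r ∈ Finset.range q, g (l + 3 * r + 2))⁻¹ *
          (∏ r ∈ Finset.range q, g (2 * l + 3 * r + 2))⁻¹) := by
      rw [H, if_neg h1, if_pos h2, hq3, hexp, Finset.prod_mul_distrib, Finset.prod_mul_distrib,
        Finset.prod_inv_distrib, Finset.prod_inv_distrib]
      simp only [hg]
      push_cast
      ring_nf
    -- The same sorting; as `l ≡ 2`, the offsets are now `0, 1, 2`.
    have hn1 : ∏ j ∈ Finset.range l, g (3 * j) = (∏ r ∈ Finset.range (q + 1), g (3 * r)) *
        (∏ r ∈ Finset.range (q + 1), g (l + 3 * r + 1)) *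
          ∏ r ∈ Finset.range q, g (2 * l + 3 * r + 2) := by
      rw [show Finset.range l = Finset.range (q + 1 + (q + 1) + q) by congr 1; lia,
        Finset.prod_range_add, Finset.prod_range_add]
      congr 1
      · congr 1
        exact Finset.prod_congr rfl fun r _ => congrArg g (by lia)
      · exact Finset.prod_congr rfl fun r _ => congrArg g (by lia)
    have hn2 : ∏ j ∈ Finset.range l, g (3 * j + 2) = (∏ r ∈ Finset.range q, g (3 * r + 2)) *
        (∏ r ∈ Finset.range (q + 1), g (l + 3 * r)) *
          ∏ r ∈ Finset.range (q + 1), g (2 * l + 3 * r + 1) := by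
      rw [show Finset.range l = Finset.range (q + (q + 1) + (q + 1)) by congr 1; lia,
        Finset.prod_range_add, Finset.prod_range_add]
      congr 1
      · congr 1
        exact Finset.prod_congr rfl fun r _ => congrArg g (by lia)
      · exact Finset.prod_congr rfl fun r _ => congrArg g (by lia)
    rw [hH', hH, ← hEl, hn1, hn2, exp_add_shift s hl]
    have := hP0 (q + 1) fun r => 3 * r
    have := hP0 (q + 1) fun r => l + 3 * r + 1
    have := hP0 q fun r => 2 * l + 3 * r + 2
    have := hP0 q fun r => l + 3 * r + 2
    have := hP0 q fun r => 3 * r + 2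
    field_simp
  -- Translation by `l` now preserves residues modulo 3, so nothing would be exchanged between
  -- blocks; the recursion of `Γ₂` produces the gamma factors instead.
  · obtain ⟨q, hq⟩ : ∃ q, l = 3 * q := ⟨l / 3, by lia⟩
    have hq3 : l / 3 = q := by lia
    have hq0 : 0 < q := by lia
    have hqC : (q : ℂ) ≠ 0 := Nat.cast_ne_zero.mpr hq0.ne'
    have hlq : (l : ℝ) / 3 = q := by rw [hq]; push_cast; field_simp
    obtain ⟨c, hc, hΓ⟩ := exists_Gamma2_add_one
    have hpos : ∀ m : ℕ, 0 < ((s + l + m) / l).re := fun m => by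
      rw [← Complex.ofReal_natCast l, Complex.div_ofReal_re, add_re, natCast_re]
      have : (0 : ℝ) ≤ m := m.cast_nonneg
      rw [ofReal_natCast]
      positivity
    have hstep : ∀ m : ℕ, Gamma2 ((s + l + l + m) / l) =
        c * (Gamma2 ((s + l + m) / l) * (Complex.Gamma ((s + l + m) / l))⁻¹) := fun m => by
      rw [← hΓ _ (hpos m)]
      congr 1
      field_simp
      ring
    have hsH : ∀ t : ℂ, H l t = Complex.exp (2 / 3 * t / l * Real.log q) *
        ∏ j ∈ Finset.range q, Gamma2 ((t + l + (3 * j : ℕ)) / l) *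
          (Gamma2 ((t + l + (3 * j + 2 : ℕ)) / l))⁻¹ := fun t => by
      rw [H, if_neg h1, if_neg h2, hq3, hlq, hexp]
      push_cast
      simp only [add_assoc]
    rw [hsH (s + l), hsH s, exp_add_shift s hl, ← hE q hq0]
    have hprod : ∏ j ∈ Finset.range q, Gamma2 ((s + l + l + (3 * j : ℕ)) / l) *
          (Gamma2 ((s + l + l + (3 * j + 2 : ℕ)) / l))⁻¹ =
        (∏ j ∈ Finset.range q, Gamma2 ((s + l + (3 * j : ℕ)) / l) *
          (Gamma2 ((s + l + (3 * j + 2 : ℕ)) / l))⁻¹) *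
        ∏ j ∈ Finset.range q, (Complex.Gamma (((s + l) / 3 + j) / q))⁻¹ *
          Complex.Gamma (((s + l) / 3 + 2 / 3 + j) / q) := by
      rw [← Finset.prod_mul_distrib]
      refine Finset.prod_congr rfl fun j _ => ?_
      have e1 : ((s + l) / 3 + j) / q = (s + l + (3 * j : ℕ)) / l := by
        rw [hq]; push_cast; field_simp
      have e2 : ((s + l) / 3 + 2 / 3 + j) / q = (s + l + (3 * j + 2 : ℕ)) / l := by
        rw [hq]; push_cast; field_simp; ring
      rw [hstep, hstep, e1, e2, mul_inv, mul_inv, inv_inv]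
      field_simp
    rw [hprod]
    ring

/-! ### Fourier transforms of the elliptic kernels -/

/-- With `σ = e^y (1 - σ)` and Jacobian `σ (1 - σ)`, the integrand of `B(s, 1 - s)` becomes `σ^s (1
- σ)^{1-s} = e^{sy} (1 - σ)`. -/
theorem sigmoid_beta_integrand (s : ℂ) (y : ℝ) :
    |Real.sigmoid y * (1 - Real.sigmoid y)| •
      ((Real.sigmoid y : ℂ) ^ (s - 1) * (1 - (Real.sigmoid y : ℂ)) ^ ((1 - s) - 1)) =
      Complex.exp (s * y) / (1 + Complex.exp y) := by
  have hσ := Real.sigmoid_pos y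
  have hσ' : 0 < 1 - Real.sigmoid y := by linarith [Real.sigmoid_lt_one y]
  have h1 : Real.sigmoid y = Real.exp y * (1 - Real.sigmoid y) := by
    rw [← Real.sigmoid_neg, ← Real.sigmoid_mul_rexp_neg, mul_left_comm, ← Real.exp_add]
    simp
  have h2 : Real.log (Real.sigmoid y) = y + Real.log (1 - Real.sigmoid y) := by
    conv_lhs => rw [h1]
    rw [Real.log_mul (Real.exp_ne_zero _) hσ'.ne', Real.log_exp]
  have h3 : (1 + Complex.exp y)⁻¹ = Complex.exp (Real.log (1 - Real.sigmoid y) : ℂ) := by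
    rw [← Complex.ofReal_exp (Real.log _), Real.exp_log hσ', ← Real.sigmoid_neg,
      Real.sigmoid_def, neg_neg]
    push_cast
    rfl
  have e1 : (Real.sigmoid y : ℂ) = Complex.exp (Real.log (Real.sigmoid y) : ℂ) := by
    rw [← Complex.ofReal_exp, Real.exp_log hσ]
  have e2 : (1 - (Real.sigmoid y : ℂ)) = Complex.exp (Real.log (1 - Real.sigmoid y) : ℂ) := by
    rw [← Complex.ofReal_exp, Real.exp_log hσ']
    push_cast
    rfl
  have e3 : ∀ z : ℂ, (Real.sigmoid y : ℂ) ^ z =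
      Complex.exp ((Real.log (Real.sigmoid y) : ℂ) * z) := fun z => by
    rw [Complex.cpow_def_of_ne_zero (ofReal_ne_zero.mpr hσ.ne'), Complex.ofReal_log hσ.le]
  have e4 : ∀ z : ℂ, (1 - (Real.sigmoid y : ℂ)) ^ z =
      Complex.exp ((Real.log (1 - Real.sigmoid y) : ℂ) * z) := fun z => by
    have : (1 - (Real.sigmoid y : ℂ)) = ((1 - Real.sigmoid y : ℝ) : ℂ) := by push_cast; rfl
    rw [this, Complex.cpow_def_of_ne_zero (ofReal_ne_zero.mpr hσ'.ne'), Complex.ofReal_log hσ'.le]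
  rw [abs_of_pos (mul_pos hσ hσ'), Complex.real_smul, e3, e4, ofReal_mul, ofReal_sub, ofReal_one, e2]
  nth_rewrite 1 [e1]
  rw [← Complex.exp_add, ← Complex.exp_add, ← Complex.exp_add, div_eq_mul_inv, h3,
    ← Complex.exp_add, h2]
  congr 1
  push_cast
  ring

/-- The integral is `B(s, 1 - s)` after the sigmoid substitution, evaluated by Euler's reflection
formula. -/
theorem integrable_and_integral_exp_div_one_add_exp {s : ℂ} (h0 : 0 < s.re) (h1 : s.re < 1) :
    Integrable (fun y : ℝ => Complex.exp (s * y) / (1 + Complex.exp y)) ∧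
      ∫ y : ℝ, Complex.exp (s * y) / (1 + Complex.exp y) =
        Real.pi / Complex.sin (Real.pi * s) := by
  have h1' : 0 < (1 - s).re := by simpa using h1
  set g : ℝ → ℂ := fun x => (x : ℂ) ^ (s - 1) * (1 - (x : ℂ)) ^ ((1 - s) - 1) with hg
  have hder : ∀ x ∈ (Set.univ : Set ℝ), HasDerivWithinAt Real.sigmoid
      (Real.sigmoid x * (1 - Real.sigmoid x)) Set.univ x := fun x _ =>
    (Real.hasDerivAt_sigmoid x).hasDerivWithinAt
  have hinj : Set.InjOn Real.sigmoid Set.univ := Real.sigmoid_injective.injOn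
  have himg : Real.sigmoid '' Set.univ = Set.Ioo 0 1 := by rw [Set.image_univ, Real.range_sigmoid]
  have hI := integrableOn_image_iff_integrableOn_abs_deriv_smul MeasurableSet.univ hder hinj g
  have hV := integral_image_eq_integral_abs_deriv_smul MeasurableSet.univ hder hinj g
  simp only [himg, hg, sigmoid_beta_integrand, integrableOn_univ, Measure.restrict_univ] at hI hV
  have hc := Complex.betaIntegral_convergent h0 h1'
  rw [intervalIntegrable_iff_integrableOn_Ioo_of_le zero_le_one] at hc
  refine ⟨hI.mp hc, ?_⟩
  have hb := Complex.Gamma_mul_Gamma_eq_betaIntegral h0 h1'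
  rw [Complex.Gamma_mul_Gamma_one_sub, add_sub_cancel, Complex.Gamma_one, one_mul,
    Complex.betaIntegral, intervalIntegral.integral_of_le zero_le_one,
    integral_Ioc_eq_integral_Ioo] at hb
  rw [← hV, hb]

theorem kernel2_mul_exp (δ t r : ℝ) :
    (kernel2 r : ℂ) * Complex.exp ((2 * δ - I * t) * r) =
      Complex.exp ((1 / 2 + δ / Real.pi - I * t / (2 * Real.pi)) * ((2 * Real.pi * r : ℝ) : ℂ)) /
        (1 + Complex.exp ((2 * Real.pi * r : ℝ) : ℂ)) := by
  have hpi : (Real.pi : ℂ) ≠ 0 := ofReal_ne_zero.mpr Real.pi_ne_zero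
  have e1 : (1 / 2 + δ / Real.pi - I * t / (2 * Real.pi)) * ((2 * Real.pi * r : ℝ) : ℂ) =
      Real.pi * r + (2 * δ - I * t) * r := by
    push_cast; field_simp; ring
  have e2 : Complex.exp ((2 * Real.pi * r : ℝ) : ℂ) =
      Complex.exp (Real.pi * r) * Complex.exp (Real.pi * r) := by
    rw [← Complex.exp_add]; congr 1; push_cast; ring
  have e3 : (kernel2 r : ℂ) =
      1 / (Complex.exp (Real.pi * r) + (Complex.exp (Real.pi * r))⁻¹) := by
    rw [kernel2, ← Complex.exp_neg]; push_cast; rfl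
  rw [e1, e2, e3, Complex.exp_add]
  have h0 := Complex.exp_ne_zero (Real.pi * r)
  have h1 : 1 + Complex.exp (Real.pi * r) * Complex.exp (Real.pi * r) ≠ 0 := by
    rw [← Complex.exp_add, show (Real.pi * r + Real.pi * r : ℂ) = ((Real.pi * r + Real.pi * r : ℝ) : ℂ)
      by push_cast; rfl, ← Complex.ofReal_exp, ← Complex.ofReal_one, ← Complex.ofReal_add]
    exact ofReal_ne_zero.mpr (by positivity)
  have h2 : Complex.exp (Real.pi * r) + (Complex.exp (Real.pi * r))⁻¹ ≠ 0 := by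
    intro h
    apply h1
    field_simp at h
    linear_combination h
  field_simp
  ring

/-- The real twist `δ` is there for the order 3 kernel, which is the sum of the twists `δ = ±π/6` of
`kernel2`. The bound on `δ` is exactly `0 < Re s < 1` after `y = 2πr`. -/
theorem integrable_and_integral_kernel2_mul_exp (δ t : ℝ) (hδ : |δ| < Real.pi / 2) :
    Integrable (fun r : ℝ => (kernel2 r : ℂ) * Complex.exp ((2 * δ - I * t) * r)) ∧
      ∫ r : ℝ, (kernel2 r : ℂ) * Complex.exp ((2 * δ - I * t) * r) =
        1 / (2 * Complex.cos ((t / 2 : ℝ) * I - δ)) := by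
  have hpi := Real.pi_pos
  obtain ⟨hδ1, hδ2⟩ := abs_lt.mp hδ
  set s : ℂ := 1 / 2 + δ / Real.pi - I * t / (2 * Real.pi) with hs
  have hre : s.re = 1 / 2 + δ / Real.pi := by
    have : s = ((1 / 2 + δ / Real.pi : ℝ) : ℂ) + ((-(t / (2 * Real.pi)) : ℝ) : ℂ) * I := by
      rw [hs]; push_cast; ring
    rw [this, add_re, ofReal_re, re_ofReal_mul, I_re, mul_zero, add_zero]
  have h0 : 0 < s.re := by
    rw [hre]
    have : -(1 / 2) < δ / Real.pi := by rw [lt_div_iff₀ hpi]; linarith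
    linarith
  have h1 : s.re < 1 := by
    rw [hre]
    have : δ / Real.pi < 1 / 2 := by rw [div_lt_iff₀ hpi]; linarith
    linarith
  obtain ⟨hI, hV⟩ := integrable_and_integral_exp_div_one_add_exp h0 h1
  simp only [kernel2_mul_exp]
  rw [← hs]
  refine ⟨(integrable_comp_mul_left_iff
    (fun y : ℝ => Complex.exp (s * y) / (1 + Complex.exp y)) (by positivity)).mpr hI, ?_⟩
  rw [Measure.integral_comp_mul_left
    (fun y : ℝ => Complex.exp (s * y) / (1 + Complex.exp y)) (2 * Real.pi), hV]
  have hpiC : (Real.pi : ℂ) ≠ 0 := ofReal_ne_zero.mpr Real.pi_ne_zero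
  have e : (Real.pi : ℂ) * s = Real.pi / 2 - ((t / 2 : ℝ) * I - δ) := by
    rw [hs]; push_cast; field_simp; ring
  rw [e, Complex.sin_pi_div_two_sub, abs_of_pos (by positivity), Complex.real_smul]
  push_cast
  field_simp

/-- `k` is an even integrable kernel whose Fourier transform is
`C e^{-t/2} (1 - e^{-ct}) / (1 - e^{-dt})` for `t > 0`. -/
structure IsEllipticKernel (k : ℝ → ℝ) (C c d : ℝ) : Prop where
  integrable : Integrable k
  even : ∀ r, k (-r) = k r
  fourier : ∀ t : ℝ, 0 < t → ∫ r : ℝ, (k r : ℂ) * Complex.exp (-(I * t * r)) =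
    C * ((Real.exp (-t / 2) * ((1 - Real.exp (-(c * t))) / (1 - Real.exp (-(d * t)))) : ℝ) : ℂ)

/-- In the variable `x = e^{-t/2}` the Fourier transforms become rational functions. -/
theorem exp_half_facts {t : ℝ} (ht : 0 < t) : ∃ x : ℝ, 0 < x ∧ x < 1 ∧ Real.exp (-t / 2) = x ∧
    (∀ n : ℕ, Real.exp (-(n * t)) = x ^ (2 * n)) ∧
    Complex.cos ((t / 2 : ℝ) * I) = (((x + x⁻¹) / 2 : ℝ) : ℂ) := by
  refine ⟨Real.exp (-t / 2), Real.exp_pos _, Real.exp_lt_one_iff.mpr (by linarith), rfl,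
    fun n => ?_, ?_⟩
  · rw [← Real.exp_nat_mul]; congr 1; push_cast; ring
  · rw [Complex.cos_mul_I, Complex.cosh, ← Real.exp_neg]
    push_cast
    rw [add_comm]
    congr 3 <;> ring

theorem integrable_kernel2 : Integrable kernel2 := by
  have h := (integrable_and_integral_kernel2_mul_exp 0 0 (by simpa using Real.pi_pos)).1.re
  simpa using h

theorem isEllipticKernel_kernel2 : IsEllipticKernel kernel2 1 1 2 := by
  refine ⟨integrable_kernel2, fun r => ?_, fun t ht => ?_⟩
  · simp [kernel2, add_comm]
  · have h := (integrable_and_integral_kernel2_mul_exp 0 t (by simpa using Real.pi_pos)).2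
    simp only [ofReal_zero, mul_zero, zero_sub, sub_zero, neg_mul] at h
    rw [h]
    obtain ⟨x, hx0, hx1, e1, e2, e3⟩ := exp_half_facts ht
    have e4 := e2 1
    have e5 := e2 2
    push_cast at e4 e5
    rw [e3, e1, e4, e5]
    have h4 : 1 - x ^ (2 * 2) ≠ 0 := by
      have : x ^ (2 * 2) < 1 := pow_lt_one₀ hx0.le hx1 (by norm_num)
      linarith
    rw [ofReal_one, one_mul, ← ofReal_ofNat, ← ofReal_mul, ← ofReal_one, ← ofReal_div]
    congr 1
    have h2 : x ^ 2 + 1 ≠ 0 := by positivity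
    field_simp
    ring

theorem kernel3_eq (r : ℝ) : (kernel3 r : ℂ) =
    (kernel2 r : ℂ) * Complex.exp (Real.pi * r / 3) +
      (kernel2 r : ℂ) * Complex.exp (-(Real.pi * r / 3)) := by
  rw [kernel3, kernel2]
  push_cast
  ring

theorem isEllipticKernel_kernel3 : IsEllipticKernel kernel3 (Real.sqrt 3) 2 3 := by
  have hpi := Real.pi_pos
  have hδ : |Real.pi / 6| < Real.pi / 2 := by rw [abs_of_pos (by positivity)]; linarith
  have hδ' : |-(Real.pi / 6)| < Real.pi / 2 := by rwa [abs_neg]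
  have hk : ∀ t r : ℝ, (kernel3 r : ℂ) * Complex.exp (-(I * t * r)) =
      (kernel2 r : ℂ) * Complex.exp ((2 * (Real.pi / 6 : ℝ) - I * t) * r) +
      (kernel2 r : ℂ) * Complex.exp ((2 * (-(Real.pi / 6) : ℝ) - I * t) * r) := by
    intro t r
    rw [kernel3_eq, add_mul, mul_assoc (kernel2 r : ℂ), mul_assoc (kernel2 r : ℂ), ← Complex.exp_add, ← Complex.exp_add]
    congr 3 <;> (push_cast; ring)
  have hint := fun t => integrable_and_integral_kernel2_mul_exp (Real.pi / 6) t hδ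
  have hint' := fun t => integrable_and_integral_kernel2_mul_exp (-(Real.pi / 6)) t hδ'
  refine ⟨?_, fun r => ?_, fun t ht => ?_⟩
  · have h := ((hint 0).1.add (hint' 0).1).re
    refine h.congr (ae_of_all _ fun r => ?_)
    simp only [Pi.add_apply, ← hk]
    simp
  · simp [kernel3, add_comm, neg_div]
  · simp only [hk]
    rw [integral_add (hint t).1 (hint' t).1, (hint t).2, (hint' t).2]
    obtain ⟨x, hx0, hx1, e1, e2, e3⟩ := exp_half_facts ht
    have e4 := e2 2
    have e5 := e2 3
    push_cast at e4 e5
    have h6 : 1 - x ^ (2 * 3) ≠ 0 := by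
      have : x ^ (2 * 3) < 1 := pow_lt_one₀ hx0.le hx1 (by norm_num)
      linarith
    set z : ℂ := (t / 2 : ℝ) * I with hz
    have hcos : Complex.cos (Real.pi / 6 : ℝ) = ((Real.sqrt 3 / 2 : ℝ) : ℂ) := by
      rw [← Complex.ofReal_cos, Real.cos_pi_div_six]
    have hsin : Complex.sin (Real.pi / 6 : ℝ) = ((1 / 2 : ℝ) : ℂ) := by
      rw [← Complex.ofReal_sin, Real.sin_pi_div_six]
    have h3 : ((Real.sqrt 3 : ℝ) : ℂ) ^ 2 = 3 := by
      rw [← ofReal_pow, Real.sq_sqrt (by norm_num)]; push_cast; rfl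
    have hsq := Complex.sin_sq_add_cos_sq z
    -- In terms of `x` this common denominator is `x² + 1 + x⁻²`, a factor of `1 - x⁶` up to a power
    -- of `x`; hence `d = 3`.
    have hprod : (2 * Complex.cos (z - (Real.pi / 6 : ℝ))) *
        (2 * Complex.cos (z - (-(Real.pi / 6) : ℝ))) = 4 * Complex.cos z ^ 2 - 1 := by
      rw [ofReal_neg, sub_neg_eq_add, Complex.cos_sub, Complex.cos_add, hcos, hsin]
      push_cast
      linear_combination (Complex.cos z ^ 2) * h3 - hsq
    have hsum : 2 * Complex.cos (z - (Real.pi / 6 : ℝ)) +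
        2 * Complex.cos (z - (-(Real.pi / 6) : ℝ)) = 2 * Real.sqrt 3 * Complex.cos z := by
      rw [ofReal_neg, sub_neg_eq_add, Complex.cos_sub, Complex.cos_add, hcos, hsin]
      push_cast
      ring
    have hne : 4 * Complex.cos z ^ 2 - 1 ≠ 0 := by
      rw [e3]
      have : (4 * ((((x + x⁻¹) / 2 : ℝ) : ℂ)) ^ 2 - 1) = ((x ^ 2 + 1 + (x⁻¹) ^ 2 : ℝ) : ℂ) := by
        have : (x : ℂ) ≠ 0 := ofReal_ne_zero.mpr hx0.ne'
        push_cast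
        field_simp
        ring
      rw [this]
      exact ofReal_ne_zero.mpr (by positivity)
    rw [← hprod] at hne
    rw [div_add_div _ _ (left_ne_zero_of_mul hne) (right_ne_zero_of_mul hne), one_mul, mul_one,
      add_comm, hsum, hprod, e3, e1, e4, e5]
    rw [mul_comm (2 : ℂ), mul_assoc, mul_div_assoc]
    congr 1
    have hreal : (x + x⁻¹) / (4 * ((x + x⁻¹) / 2) ^ 2 - 1) = x * ((1 - x ^ 4) / (1 - x ^ 6)) := by
      have hx2 : 4 * ((x + x⁻¹) / 2) ^ 2 - 1 ≠ 0 := by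
        have : 4 * ((x + x⁻¹) / 2) ^ 2 - 1 = x ^ 2 + 1 + (x⁻¹) ^ 2 := by field_simp; ring
        rw [this]; positivity
      rw [← mul_div_assoc, div_eq_div_iff hx2 h6]
      field_simp
      ring
    rw [← hreal]
    push_cast
    ring

/-! ### Elliptic kernels integrated against `1 / (a + ir)` and `1 / (a + ir)²`. -/

theorem norm_ofReal_add_mul_I_ge {a : ℂ} (r : ℝ) : a.re ≤ ‖a + I * r‖ := by
  have h := Complex.re_le_norm (a + I * r)
  simpa using h

theorem add_mul_I_ne_zero {a : ℂ} (ha : 0 < a.re) (r : ℝ) : a + I * r ≠ 0 :=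
  norm_pos_iff.mp (ha.trans_le (norm_ofReal_add_mul_I_ge r))

/-- Euler's constant and the terms `1 / (k + 1)` cancel between the two digamma series. -/
theorem hasSum_logDeriv_Gamma_quotient {c d : ℝ} (hc : 0 ≤ c) (hd : 0 < d) {E : ℂ → ℂ}
    (hE : ∀ s : ℂ, 0 < s.re → E s = (Complex.Gamma (s / d))⁻¹ * Complex.Gamma ((s + c) / d))
    {s : ℂ} (hs : 0 < s.re) :
    HasSum (fun k : ℕ => 1 / (s + d * k) - 1 / (s + c + d * k)) (logDeriv E s) := by
  have hdC : (d : ℂ) ≠ 0 := ofReal_ne_zero.mpr hd.ne'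
  have h := ((isRealLog_Gamma.comp_affine (b := 0) 0 d hd (by simp)).inv.mul
    (isRealLog_Gamma.comp_affine (b := 0) c d hd (by simpa using hc))).congr (g := E)
    (fun s hs => by simpa using (hE s hs).symm)
  rw [h.logDeriv_eq hs]
  simp only [ofReal_zero, add_zero]
  have h1 : 0 < (s / d).re := by rw [Complex.div_ofReal_re]; positivity
  have h2 : 0 < ((s + c) / d).re := by
    rw [Complex.div_ofReal_re, add_re, ofReal_re]; positivity
  have h3 := ((summable_and_hasDerivAt_digammaTerm h2).1.hasSum.sub
    (summable_and_hasDerivAt_digammaTerm h1).1.hasSum).mul_left ((d : ℂ)⁻¹)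
  have e : -((d : ℂ)⁻¹ * digammaSeries (s / d)) + (d : ℂ)⁻¹ * digammaSeries ((s + c) / d) =
      (d : ℂ)⁻¹ * (∑' k : ℕ, (1 / ((k : ℂ) + 1) - 1 / (k + (s + c) / d)) -
        ∑' k : ℕ, (1 / ((k : ℂ) + 1) - 1 / (k + s / d))) := by
    rw [digammaSeries, digammaSeries]; ring
  rw [e]
  refine h3.congr_fun fun k => ?_
  have e1 : s + d * k = d * (k + s / d) := by field_simp; ring
  have e2 : s + c + d * k = d * (k + (s + c) / d) := by field_simp; ring
  rw [e1, e2]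
  simp only [one_div, mul_inv]
  ring

theorem integral_exp_neg_mul_Ioi {b : ℂ} (hb : 0 < b.re) :
    IntegrableOn (fun t : ℝ => Complex.exp (-(b * t))) (Set.Ioi 0) ∧
      ∫ t in Set.Ioi (0 : ℝ), Complex.exp (-(b * t)) = 1 / b := by
  have hb' : (-b).re < 0 := by simpa using hb
  have h1 := integrableOn_exp_mul_complex_Ioi hb' 0
  have h2 := integral_exp_mul_complex_Ioi hb' 0
  simp only [neg_mul] at h1 h2
  refine ⟨h1, h2.trans ?_⟩
  simp [one_div]

/-- Expand `1 / (1 - e^{-dt})` geometrically and integrate term by term. -/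
theorem hasSum_integral_laplace {c d : ℝ} (hc : 0 ≤ c) (hd : 0 < d) {b : ℂ} (hb : 0 < b.re)
    (hsum : Summable fun k : ℕ => 1 / (b.re + d * k) - 1 / (b.re + c + d * k)) :
    HasSum (fun k : ℕ => 1 / (b + d * k) - 1 / (b + c + d * k))
      (∫ t in Set.Ioi (0 : ℝ), Complex.exp (-(b * t)) *
        (((1 - Real.exp (-(c * t))) / (1 - Real.exp (-(d * t))) : ℝ) : ℂ)) := by
  set F : ℕ → ℝ → ℂ := fun k t =>
    Complex.exp (-((b + d * k) * t)) - Complex.exp (-((b + c + d * k) * t)) with hF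
  have hre1 : ∀ (b : ℂ) (k : ℕ), 0 < b.re → 0 < (b + d * k).re := fun b k hb => by
    have : (0 : ℝ) ≤ k := k.cast_nonneg
    simp
    positivity
  have hre2 : ∀ (b : ℂ) (k : ℕ), 0 < b.re → 0 < (b + c + d * k).re := fun b k hb => by
    have : (0 : ℝ) ≤ k := k.cast_nonneg
    simp
    positivity
  have hint : ∀ (b : ℂ) (k : ℕ), 0 < b.re → IntegrableOn (fun t : ℝ =>
      Complex.exp (-((b + d * k) * t)) - Complex.exp (-((b + c + d * k) * t))) (Set.Ioi 0) ∧
      ∫ t in Set.Ioi (0 : ℝ), (Complex.exp (-((b + d * k) * t)) -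
        Complex.exp (-((b + c + d * k) * t))) = 1 / (b + d * k) - 1 / (b + c + d * k) := by
    intro b k hb
    have h1 := integral_exp_neg_mul_Ioi (hre1 b k hb)
    have h2 := integral_exp_neg_mul_Ioi (hre2 b k hb)
    exact ⟨h1.1.sub h2.1, by rw [integral_sub h1.1 h2.1, h1.2, h2.2]⟩
  have hfac : ∀ (k : ℕ) (t : ℝ), F k t = Complex.exp (-(b * t)) *
      (((1 - Real.exp (-(c * t))) * Real.exp (-(d * t)) ^ k : ℝ) : ℂ) := by
    intro k t
    simp only [hF]
    push_cast
    rw [← Complex.exp_nat_mul, sub_mul, one_mul, mul_sub, ← Complex.exp_add, ← Complex.exp_add,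
      ← Complex.exp_add]
    congr 2 <;> ring
  have hfac' : ∀ (k : ℕ) (t : ℝ), Complex.exp (-(((b.re : ℂ) + d * k) * t)) -
      Complex.exp (-(((b.re : ℂ) + c + d * k) * t)) =
      ((Real.exp (-(b.re * t)) * ((1 - Real.exp (-(c * t))) * Real.exp (-(d * t)) ^ k) : ℝ) : ℂ) := by
    intro k t
    push_cast
    rw [← Complex.exp_nat_mul, sub_mul, one_mul, mul_sub, ← Complex.exp_add, ← Complex.exp_add,
      ← Complex.exp_add]
    congr 2 <;> ring
  have hc1 : ∀ t : ℝ, 0 < t → 0 ≤ 1 - Real.exp (-(c * t)) := fun t ht => by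
    have : Real.exp (-(c * t)) ≤ 1 := Real.exp_le_one_iff.mpr (by nlinarith)
    linarith
  -- The factor besides `e^{-bt}` is nonnegative, so taking norms just replaces `b` by its real
  -- part; hence the form of `hsum`.
  have hnorm : ∀ k : ℕ, ∫ t in Set.Ioi (0 : ℝ), ‖F k t‖ =
      1 / (b.re + d * k) - 1 / (b.re + c + d * k) := by
    intro k
    have h1 := (hint (b.re : ℂ) k (by simpa using hb)).2
    simp only [hfac'] at h1
    rw [integral_complex_ofReal] at h1
    have h2 : (1 / ((b.re : ℂ) + d * k) - 1 / ((b.re : ℂ) + c + d * k)) =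
      ((1 / (b.re + d * k) - 1 / (b.re + c + d * k) : ℝ) : ℂ) := by push_cast; rfl
    rw [h2] at h1
    rw [← ofReal_inj.mp h1]
    refine setIntegral_congr_fun measurableSet_Ioi fun t ht => ?_
    have h3 := hc1 t ht
    simp only [hfac]
    rw [norm_mul, Complex.norm_exp, Complex.norm_real, Real.norm_of_nonneg (by positivity)]
    simp
  have hmain := hasSum_integral_of_summable_integral_norm (μ := volume.restrict (Set.Ioi (0 : ℝ)))
    (F := F) (fun k => (hint b k hb).1) (by simpa only [hnorm] using hsum)
  have hval : ∫ t in Set.Ioi (0 : ℝ), ∑' k, F k t = ∫ t in Set.Ioi (0 : ℝ), Complex.exp (-(b * t)) *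
        (((1 - Real.exp (-(c * t))) / (1 - Real.exp (-(d * t))) : ℝ) : ℂ) := by
    refine setIntegral_congr_fun measurableSet_Ioi fun t ht => ?_
    have ht' : (0 : ℝ) < t := ht
    simp only [hfac]
    rw [tsum_mul_left, ← Complex.ofReal_tsum, tsum_mul_left,
      tsum_geometric_of_lt_one (Real.exp_pos _).le
        (Real.exp_lt_one_iff.mpr (by nlinarith [mul_pos hd ht'])), ← div_eq_mul_inv]
  rw [hval] at hmain
  exact hmain.congr_fun fun k => ((hint b k hb).2).symm

namespace IsEllipticKernel

variable {k : ℝ → ℝ} {C c d : ℝ}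

theorem integrable_ofReal (hk : IsEllipticKernel k C c d) : Integrable fun r => (k r : ℂ) :=
  hk.integrable.ofReal

theorem integrable_div (hk : IsEllipticKernel k C c d) {a : ℂ} (ha : 0 < a.re) :
    Integrable fun r : ℝ => 1 / (a + I * r) * (k r : ℂ) := by
  refine hk.integrable_ofReal.bdd_mul (c := 1 / a.re) ?_ (ae_of_all _ fun r => ?_)
  · refine Continuous.aestronglyMeasurable ?_
    exact continuous_const.div (by fun_prop) (add_mul_I_ne_zero ha)
  · rw [norm_div, norm_one]
    exact one_div_le_one_div_of_le ha (norm_ofReal_add_mul_I_ge r)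

theorem norm_integral_div_le (hk : IsEllipticKernel k C c d) {a : ℂ} (ha : 0 < a.re) :
    ‖∫ r : ℝ, 1 / (a + I * r) * (k r : ℂ)‖ ≤ 1 / a.re * ∫ r, ‖k r‖ := by
  rw [← integral_const_mul]
  refine norm_integral_le_of_norm_le (hk.integrable.norm.const_mul _) (ae_of_all _ fun r => ?_)
  rw [norm_mul, norm_div, norm_one, Complex.norm_real]
  have := norm_ofReal_add_mul_I_ge (a := a) r
  gcongr

theorem integral_div (hk : IsEllipticKernel k C c d) (hc : 0 ≤ c) (hd : 0 < d) {E : ℂ → ℂ}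
    (hE : ∀ s : ℂ, 0 < s.re → E s = (Complex.Gamma (s / d))⁻¹ * Complex.Gamma ((s + c) / d))
    {a : ℂ} (ha : 0 < a.re) :
    ∫ r : ℝ, 1 / (a + I * r) * (k r : ℂ) = C * logDeriv E (a + 1 / 2) := by
  have hb : 0 < (a + 1 / 2).re := by simp; positivity
  have hsum : Summable fun n : ℕ => 1 / ((a + 1 / 2).re + d * n) -
      1 / ((a + 1 / 2).re + c + d * n) := by
    have h := (hasSum_logDeriv_Gamma_quotient hc hd hE (s := ((a + 1 / 2).re : ℂ))
      (by simpa using hb)).summable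
    rw [← Complex.summable_ofReal]
    refine h.congr fun n => ?_
    push_cast
    rfl
  have hL := (hasSum_integral_laplace hc hd hb hsum).unique
    (hasSum_logDeriv_Gamma_quotient hc hd hE hb)
  rw [← hL, ← integral_const_mul]
  -- A product of integrable functions of `r` and `t`, times a factor of modulus 1.
  have hprod : Integrable (Function.uncurry fun (r t : ℝ) =>
      (k r : ℂ) * Complex.exp (-((a + I * r) * t)))
      (volume.prod (volume.restrict (Set.Ioi (0 : ℝ)))) := by
    have h1 := hk.integrable_ofReal.mul_prod (integral_exp_neg_mul_Ioi ha).1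
    have h2 := h1.bdd_mul (f := fun z : ℝ × ℝ => Complex.exp (-(I * z.2 * z.1))) (c := 1)
      (Continuous.aestronglyMeasurable (by fun_prop)) (ae_of_all _ fun z => by
        rw [Complex.norm_exp]; simp)
    refine h2.congr (ae_of_all _ fun z => ?_)
    simp only [Function.uncurry]
    rw [mul_left_comm, ← Complex.exp_add]
    congr 2
    ring
  calc ∫ r : ℝ, 1 / (a + I * r) * (k r : ℂ)
      = ∫ r : ℝ, ∫ t in Set.Ioi (0 : ℝ), (k r : ℂ) * Complex.exp (-((a + I * r) * t)) := by
        refine integral_congr_ae (ae_of_all _ fun r => ?_)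
        simp only
        rw [integral_const_mul, (integral_exp_neg_mul_Ioi (b := a + I * r) (by simpa using ha)).2,
          mul_comm]
    _ = ∫ t in Set.Ioi (0 : ℝ), ∫ r : ℝ, (k r : ℂ) * Complex.exp (-((a + I * r) * t)) :=
        integral_integral_swap hprod
    _ = _ := by
        refine setIntegral_congr_fun measurableSet_Ioi fun t ht => ?_
        have e : ∀ r : ℝ, (k r : ℂ) * Complex.exp (-((a + I * r) * t)) =
            Complex.exp (-(a * t)) * ((k r : ℂ) * Complex.exp (-(I * t * r))) := fun r => by
          rw [mul_left_comm, ← Complex.exp_add]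
          congr 2
          ring
        simp only [e]
        rw [integral_const_mul, hk.fourier t ht, ofReal_mul, ← mul_assoc, ← mul_assoc,
          mul_comm (Complex.exp _) (C : ℂ), mul_assoc (C : ℂ), mul_assoc (C : ℂ), ofReal_exp,
          ← Complex.exp_add]
        congr 3
        push_cast
        ring

/-- Differentiate `integral_div` in `a` under the integral sign; on `Re a` bounded below the
derivative is dominated by a multiple of `|k|`. -/
theorem integral_div_sq (hk : IsEllipticKernel k C c d) (hc : 0 ≤ c) (hd : 0 < d)
    {E L L' L'' : ℂ → ℂ} (hL : IsRealLog E L L' L'' 0)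
    (hE : ∀ s : ℂ, 0 < s.re → E s = (Complex.Gamma (s / d))⁻¹ * Complex.Gamma ((s + c) / d))
    {a : ℂ} (ha : 0 < a.re) :
    Integrable (fun r : ℝ => 1 / (a + I * r) ^ 2 * (k r : ℂ)) ∧
      ∫ r : ℝ, 1 / (a + I * r) ^ 2 * (k r : ℂ) = -(C * L'' (a + 1 / 2)) := by
  set δ := a.re / 2 with hδ
  have hδ0 : 0 < δ := by positivity
  have hmeas : ∀ {x : ℂ}, 0 < x.re → AEStronglyMeasurable
      (fun r : ℝ => -(1 / (x + I * r) ^ 2 * (k r : ℂ))) volume := by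
    intro x hx
    refine (AEStronglyMeasurable.mul ?_ hk.integrable_ofReal.aestronglyMeasurable).neg
    exact (continuous_const.div (by fun_prop) fun r => pow_ne_zero 2
      (add_mul_I_ne_zero hx r)).aestronglyMeasurable
  have hder := hasDerivAt_integral_of_dominated_loc_of_deriv_le (μ := volume)
    (F := fun (x : ℂ) (r : ℝ) => 1 / (x + I * r) * (k r : ℂ)) (x₀ := a) (s := {z : ℂ | δ < z.re})
    (bound := fun r => 1 / δ ^ 2 * ‖k r‖)
    (F' := fun (x : ℂ) (r : ℝ) => -(1 / (x + I * r) ^ 2 * (k r : ℂ)))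
    (eventually_lt_re (by rw [hδ]; linarith))
    (by filter_upwards [eventually_lt_re ha] with x hx using
          (hk.integrable_div hx).aestronglyMeasurable)
    (hk.integrable_div ha) (hmeas ha)
    (ae_of_all _ fun r x hx => by
      have hx' : δ < x.re := hx
      have := hx'.le.trans (norm_ofReal_add_mul_I_ge r)
      rw [norm_neg, norm_mul, norm_div, norm_one, norm_pow, Complex.norm_real]
      gcongr)
    (hk.integrable.norm.const_mul _)
    (ae_of_all _ fun r x hx => by
      have hx' : 0 < x.re := hδ0.trans hx
      have h1 := (((hasDerivAt_id x).add_const (I * (r : ℂ))).inv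
        (add_mul_I_ne_zero hx' r)).mul_const (k r : ℂ)
      simp only [one_div]
      refine h1.congr_deriv ?_
      simp only [id]
      ring)
  have hder2 : HasDerivAt (fun x : ℂ => ∫ r : ℝ, 1 / (x + I * r) * (k r : ℂ))
      (C * L'' (a + 1 / 2)) a := by
    have hb : 0 < (a + 1 / 2).re := by simp; positivity
    refine (((hL.hasDerivAt' _ hb).comp_add_const a (1 / 2)).const_mul (C : ℂ)).congr_of_eventuallyEq ?_
    filter_upwards [eventually_lt_re ha] with x hx
    have hb : 0 < (x + 1 / 2).re := by simp; positivity
    rw [hk.integral_div hc hd hE hx, hL.logDeriv_eq hb]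
  have h3 := hder.2.unique hder2
  rw [integral_neg, neg_eq_iff_eq_neg] at h3
  exact ⟨by simpa using hder.1.neg, h3⟩

end IsEllipticKernel

/-! ### The test function -/

/-- With `A` the base of the square, the term is `1 / A² - 1 / (A² - l²/4) = -(l/2)² / (A² (A² -
l²/4))`, and `|A| ≥ l/2` disposes of the numerator. The bound is uniform in `r`. -/
theorem norm_phiTerm_le {l : ℕ} (hl : 1 ≤ l) {s : ℂ} (hs : (1 - (l : ℝ)) / 2 < s.re) (r : ℝ)
    (m : ℕ) : ‖phiTerm l s r m‖ ≤ 1 / (s.re + l * m + l / 2 - 1 / 2) ^ 2 := by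
  have hl0 : (1 : ℝ) ≤ l := by exact_mod_cast hl
  have hlC : (l : ℂ) ≠ 0 := Nat.cast_ne_zero.mpr (by lia)
  have hm : (0 : ℝ) ≤ l * m := by positivity
  set δ : ℝ := s.re + l * m + l / 2 - 1 / 2 with hδ
  have hδ0 : 0 < δ := by rw [hδ]; linarith
  have hre : ∀ w : ℂ, w.re ≤ ‖w‖ := Complex.re_le_norm
  have hA : δ + l / 2 ≤ ‖s + l * m + l - 1 / 2 + I * r‖ := by
    refine le_trans (le_of_eq ?_) (hre _)
    simp; ring
  have hB : δ ≤ ‖s + l * m + l / 2 - 1 / 2 + I * r‖ := by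
    refine le_trans (le_of_eq ?_) (hre _)
    simp; ring
  have hC : δ + l ≤ ‖s + l * m + 3 * l / 2 - 1 / 2 + I * r‖ := by
    refine le_trans (le_of_eq ?_) (hre _)
    have : (3 * (l : ℂ) / 2) = ((3 * l / 2 : ℝ) : ℂ) := by push_cast; rfl
    rw [this]
    simp; ring
  have hA0 : s + l * m + l - 1 / 2 + I * r ≠ 0 := norm_pos_iff.mp (by linarith)
  have hB0 : s + l * m + l / 2 - 1 / 2 + I * r ≠ 0 := norm_pos_iff.mp (by linarith)
  have hC0 : s + l * m + 3 * l / 2 - 1 / 2 + I * r ≠ 0 := norm_pos_iff.mp (by linarith)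
  have e : phiTerm l s r m = -((l / 2 : ℂ) ^ 2) / ((s + l * m + l - 1 / 2 + I * r) ^ 2 *
      ((s + l * m + l / 2 - 1 / 2 + I * r) * (s + l * m + 3 * l / 2 - 1 / 2 + I * r))) := by
    rw [phiTerm]
    have eB : s + l * m + l / 2 - 1 / 2 + I * r = (s + l * m + l - 1 / 2 + I * r) - l / 2 := by ring
    have eC : s + l * m + 3 * l / 2 - 1 / 2 + I * r = (s + l * m + l - 1 / 2 + I * r) + l / 2 := by
      ring
    rw [eB] at hB0
    rw [eC] at hC0
    rw [eB, eC]
    generalize s + l * m + l - 1 / 2 + I * r = A at *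
    have h2 : A * 2 - l ≠ 0 := fun h => hB0 (by linear_combination h / 2)
    have h3 : A * 2 + l ≠ 0 := fun h => hC0 (by linear_combination h / 2)
    field_simp
    ring
  rw [e, norm_div, norm_neg, norm_mul, norm_mul, norm_pow, norm_pow]
  have hn : ‖(l / 2 : ℂ)‖ = l / 2 := by
    rw [norm_div, Complex.norm_natCast]; simp
  rw [hn]
  have hA' : (l : ℝ) / 2 ≤ ‖s + l * m + l - 1 / 2 + I * r‖ := by linarith
  have hC' : δ ≤ ‖s + l * m + 3 * l / 2 - 1 / 2 + I * r‖ := by linarith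
  calc ((l : ℝ) / 2) ^ 2 / (‖s + l * m + l - 1 / 2 + I * r‖ ^ 2 *
      (‖s + l * m + l / 2 - 1 / 2 + I * r‖ * ‖s + l * m + 3 * l / 2 - 1 / 2 + I * r‖))
      ≤ ((l : ℝ) / 2) ^ 2 / (((l : ℝ) / 2) ^ 2 * (δ * δ)) := by gcongr
    _ = 1 / δ ^ 2 := by field_simp

theorem summable_phiTerm_bound {l : ℕ} (hl : 1 ≤ l) {x : ℝ} (hx : (1 - (l : ℝ)) / 2 < x) :
    Summable fun m : ℕ => 1 / (x + l * m + l / 2 - 1 / 2) ^ 2 := by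
  have hl0 : (1 : ℝ) ≤ l := by exact_mod_cast hl
  set δ : ℝ := min (x + l / 2 - 1 / 2) 1 with hδ
  have hδ0 : 0 < δ := lt_min (by linarith) one_pos
  refine Summable.of_nonneg_of_le (fun m => by positivity) (fun m => ?_)
    (summable_div_succ_sq (1 / δ ^ 2))
  rw [div_div, ← mul_pow]
  have hm : (0 : ℝ) ≤ m := m.cast_nonneg
  have h1 : δ ≤ x + l / 2 - 1 / 2 := min_le_left _ _
  have h2 : δ ≤ 1 := min_le_right _ _
  have h3 : δ * (m + 1) ≤ x + l * m + l / 2 - 1 / 2 := by nlinarith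
  gcongr

theorem summable_phiTerm {l : ℕ} (hl : 1 ≤ l) {s : ℂ} (hs : (1 - (l : ℝ)) / 2 < s.re) (r : ℝ) :
    Summable (phiTerm l s r) :=
  Summable.of_norm_bounded (summable_phiTerm_bound hl hs) fun m => norm_phiTerm_le hl hs r m

theorem continuous_phiTerm {l : ℕ} (hl : 1 ≤ l) {s : ℂ} (hs : (1 - (l : ℝ)) / 2 < s.re) (m : ℕ) :
    Continuous fun r : ℝ => phiTerm l s r m := by
  have hl0 : (1 : ℝ) ≤ l := by exact_mod_cast hl
  have hm : (0 : ℝ) ≤ l * m := by positivity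
  have h : ∀ c : ℝ, (l : ℝ) / 2 ≤ c → ∀ r : ℝ, s + l * m + c - 1 / 2 + I * r ≠ 0 := by
    intro c hc r h
    have := congrArg Complex.re h
    simp at this
    linarith
  have h1 := h l (by linarith)
  have h2 := h (l / 2) le_rfl
  have h3 := h (3 * l / 2) (by linarith)
  push_cast at h1 h2 h3
  simp only [phiTerm]
  refine Continuous.add (Continuous.sub ?_ ?_) ?_
  · exact continuous_const.div (by fun_prop) fun r => pow_ne_zero 2 (h1 r)
  · exact continuous_const.mul (continuous_const.div (by fun_prop) h2)
  · exact continuous_const.mul (continuous_const.div (by fun_prop) h3)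

theorem continuous_phi {l : ℕ} (hl : 1 ≤ l) {s : ℂ} (hs : (1 - (l : ℝ)) / 2 < s.re) :
    Continuous fun r : ℝ => phi l s r :=
  continuous_tsum (continuous_phiTerm hl hs) (summable_phiTerm_bound hl hs) fun m r =>
    norm_phiTerm_le hl hs r m

/-! ### Telescoping along the ladder. -/

theorem hasSum_of_ladder {u : ℕ → ℂ} (hu : Tendsto u atTop (𝓝 0))
    (hs : Summable fun m => u m - u (m + 1)) : HasSum (fun m => u m - u (m + 1)) (u 0) := by
  refine (hs.hasSum_iff_tendsto_nat).mpr ?_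
  simp only [Finset.sum_range_sub']
  simpa using hu.const_sub (u 0)

theorem tendsto_add_natCast_mul_comap_re {l : ℕ} (hl : 1 ≤ l) (s : ℂ) :
    Tendsto (fun m : ℕ => s + l * m) atTop (comap Complex.re atTop) := by
  rw [tendsto_comap_iff]
  have hl0 : (0 : ℝ) < l := by positivity
  have h : Tendsto (fun m : ℕ => s.re + l * (m : ℝ)) atTop atTop :=
    tendsto_atTop_add_const_left _ _ (tendsto_natCast_atTop_atTop.const_mul_atTop hl0)
  refine h.congr fun m => ?_
  simp

namespace IsEllipticKernel

variable {k : ℝ → ℝ} {C c d : ℝ}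

/-- The contribution of one elliptic kernel to the trace formula. -/
theorem integral_testFun (hk : IsEllipticKernel k C c d) (hc : 0 ≤ c) (hd : 0 < d)
    {E F : ℂ → ℂ} {l : ℕ} (hl : 1 ≤ l) (hEL : HasRealLog E 0) (hFL : HasRealLog F (-l))
    (hE : ∀ s : ℂ, 0 < s.re → E s = (Complex.Gamma (s / d))⁻¹ * Complex.Gamma ((s + c) / d))
    (hF : ∀ s : ℂ, -(l : ℝ) < s.re → F (s + l) = F s * E (s + l))
    {s : ℂ} (hs : (1 - (l : ℝ)) / 2 < s.re) :
    Integrable (fun r : ℝ => testFun l s r * (k r : ℂ)) ∧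
      ∫ r : ℝ, testFun l s r * (k r : ℂ) =
        2 * C * (deriv (logDeriv F) s - 1 / (l : ℂ) * logDeriv E (s + l / 2)) := by
  obtain ⟨L, L', L'', hL, -⟩ := hEL
  obtain ⟨M, M', M'', hM, hM0⟩ := hFL
  have hl0 : (1 : ℝ) ≤ l := by exact_mod_cast hl
  have hm : ∀ m : ℕ, (0 : ℝ) ≤ l * m := fun m => by positivity
  -- The ladder relation for `F`, after taking second logarithmic derivatives.
  have hladder : ∀ z : ℂ, -(l : ℝ) < z.re → M'' (z + l) = M'' z + L'' (z + l) := by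
    intro z hz
    have h1 := hM.comp_affine (b := -l) l 1 one_pos (by linarith)
    have h2 := hL.comp_affine (b := -l) l 1 one_pos (by linarith)
    have h3 := h1.congr (g := fun s => F s * E ((s + (l : ℝ)) / (1 : ℝ))) fun s hs => by
      simpa using hF s hs
    simpa using h3.unique'' (hM.mul h2) hz
  set K : ℂ → ℂ := fun a => ∫ r : ℝ, 1 / (a + I * r) * (k r : ℂ) with hK
  -- The third fraction of `phiTerm` at `m` is the second one at `m + 1`, and the square term
  -- contributes the increment of `M''`.
  set u : ℕ → ℂ := fun m => C * M'' (s + l * m) - 1 / l * K (s + l * m + l / 2 - 1 / 2) with hu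
  have hre1 : ∀ m : ℕ, 0 < (s + l * m + l - 1 / 2).re := fun m => by
    have := hm m; simp; linarith
  have hre2 : ∀ m : ℕ, 0 < (s + l * m + l / 2 - 1 / 2).re := fun m => by
    have := hm m; simp; linarith
  have hre3 : ∀ m : ℕ, 0 < (s + l * m + 3 * l / 2 - 1 / 2).re := fun m => by
    have := hm m
    have h3 : (3 * (l : ℂ) / 2) = ((3 * l / 2 : ℝ) : ℂ) := by push_cast; rfl
    rw [h3]; simp; linarith
  have hterm : ∀ m : ℕ, Integrable (fun r : ℝ => phiTerm l s r m * (k r : ℂ)) ∧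
      ∫ r : ℝ, phiTerm l s r m * (k r : ℂ) = u m - u (m + 1) := by
    intro m
    have i1 := hk.integral_div_sq hc hd hL hE (hre1 m)
    have i2 := (hk.integrable_div (hre2 m)).const_mul (1 / (l : ℂ))
    have i3 := (hk.integrable_div (hre3 m)).const_mul (1 / (l : ℂ))
    have e : ∀ r : ℝ, phiTerm l s r m * (k r : ℂ) =
        1 / (s + l * m + l - 1 / 2 + I * r) ^ 2 * (k r : ℂ) -
          1 / l * (1 / (s + l * m + l / 2 - 1 / 2 + I * r) * (k r : ℂ)) +
          1 / l * (1 / (s + l * m + 3 * l / 2 - 1 / 2 + I * r) * (k r : ℂ)) := fun r => by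
      rw [phiTerm]; ring
    have i12 : Integrable fun r : ℝ => 1 / (s + l * m + l - 1 / 2 + I * r) ^ 2 * (k r : ℂ) -
        1 / l * (1 / (s + l * m + l / 2 - 1 / 2 + I * r) * (k r : ℂ)) := i1.1.sub i2
    simp only [e]
    refine ⟨i12.add i3, ?_⟩
    rw [integral_add i12 i3, integral_sub i1.1 i2, integral_const_mul,
      integral_const_mul, i1.2]
    have h1 := hladder (s + l * m) (by have := hm m; simp; linarith)
    simp only [hu, hK]
    push_cast
    rw [show s + l * (m + 1) = s + l * m + l by ring, h1,
      show s + l * m + l - 1 / 2 + 1 / 2 = s + l * m + l by ring,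
      show s + l * m + l + l / 2 - 1 / 2 = s + l * m + 3 * l / 2 - 1 / 2 by ring]
    ring
  have hbound : ∀ m : ℕ, ∫ r : ℝ, ‖phiTerm l s r m * (k r : ℂ)‖ ≤
      1 / (s.re + l * m + l / 2 - 1 / 2) ^ 2 * ∫ r, ‖k r‖ := by
    intro m
    rw [← integral_const_mul]
    refine integral_mono (hterm m).1.norm (hk.integrable.norm.const_mul _) fun r => ?_
    simp only
    rw [norm_mul, Complex.norm_real]
    gcongr
    exact norm_phiTerm_le hl hs r m
  have hsumm : Summable fun m : ℕ => ∫ r : ℝ, ‖phiTerm l s r m * (k r : ℂ)‖ :=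
    Summable.of_nonneg_of_le (fun m => integral_nonneg fun r => norm_nonneg _) hbound
      ((summable_phiTerm_bound hl hs).mul_right _)
  have hmain := hasSum_integral_of_summable_integral_norm (fun m => (hterm m).1) hsumm
  have htsum : ∀ r : ℝ, ∑' m, phiTerm l s r m * (k r : ℂ) = phi l s r * (k r : ℂ) := fun r => by
    rw [phi, tsum_mul_right]
  simp only [htsum, (hterm _).2] at hmain
  -- `M''` decays by `HasRealLog`, and `K a` is bounded by the `L¹` norm of the kernel divided by
  -- `Re a`.
  have hu0 : Tendsto u atTop (𝓝 0) := by
    have h1 := (hM0.comp (tendsto_add_natCast_mul_comap_re hl s)).const_mul (C : ℂ)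
    have h2 : Tendsto (fun m : ℕ => K (s + l * m + l / 2 - 1 / 2)) atTop (𝓝 0) := by
      refine squeeze_zero_norm (fun m => hk.norm_integral_div_le (hre2 m)) ?_
      have h3 : Tendsto (fun m : ℕ => (s + l * m + l / 2 - 1 / 2).re) atTop atTop := by
        have := tendsto_comap_iff.mp (tendsto_add_natCast_mul_comap_re hl (s + l / 2 - 1 / 2))
        refine this.congr fun m => ?_
        simp only [Function.comp]
        congr 1
        ring
      simpa using (h3.inv_tendsto_atTop).mul_const (∫ r, ‖k r‖)
    simpa [hu] using h1.sub (h2.const_mul (1 / (l : ℂ)))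
  have hint : ∫ r : ℝ, phi l s r * (k r : ℂ) =
      C * (deriv (logDeriv F) s - 1 / (l : ℂ) * logDeriv E (s + l / 2)) := by
    rw [hmain.unique (hasSum_of_ladder hu0 hmain.summable), hM.deriv_logDeriv_eq (by linarith)]
    have h2 := hre2 0
    simp only [hu, hK]
    rw [hk.integral_div hc hd hE h2]
    simp only [Nat.cast_zero, mul_zero, add_zero, sub_add_cancel]
    ring
  have hI : Integrable fun r : ℝ => phi l s r * (k r : ℂ) := by
    refine hk.integrable_ofReal.bdd_mul (c := ∑' m : ℕ, 1 / (s.re + l * m + l / 2 - 1 / 2) ^ 2)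
      (continuous_phi hl hs).aestronglyMeasurable (ae_of_all _ fun r => ?_)
    exact tsum_of_norm_bounded (summable_phiTerm_bound hl hs).hasSum
      fun m => norm_phiTerm_le hl hs r m
  have hI' : Integrable fun r : ℝ => phi l s (-r) * (k r : ℂ) := by
    refine hI.comp_neg.congr (ae_of_all _ fun r => ?_)
    simp only [ofReal_neg, hk.even]
  have hV' : ∫ r : ℝ, phi l s (-r) * (k r : ℂ) = ∫ r : ℝ, phi l s r * (k r : ℂ) := by
    rw [← integral_neg_eq_self (fun r : ℝ => phi l s r * (k r : ℂ))]
    simp only [ofReal_neg, hk.even]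
  have e : ∀ r : ℝ, testFun l s r * (k r : ℂ) = phi l s r * (k r : ℂ) + phi l s (-r) * (k r : ℂ) :=
    fun r => by rw [testFun, add_mul]
  simp only [e]
  refine ⟨hI.add hI', ?_⟩
  rw [integral_add hI hI', hV', hint]
  ring

end IsEllipticKernel

/-! ### The gamma factors -/

theorem logDeriv_cexp {Q : ℂ → ℂ} {Q' s : ℂ} (hQ : HasDerivAt Q Q' s) :
    logDeriv (fun z => Complex.exp (Q z)) s = Q' := by
  rw [logDeriv_apply, hQ.cexp.deriv, mul_div_cancel_left₀ _ (Complex.exp_ne_zero _)]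

theorem IsRealLog.hasDerivAt_logBranch {f L L' L'' : ℂ → ℂ} {a : ℝ} (h : IsRealLog f L L' L'' a)
    (ha : a < 1) {s : ℂ} (hs : a < s.re) : HasDerivAt (logBranch f) (logDeriv f s) s := by
  rw [h.logDeriv_eq hs]
  refine (h.hasDerivAt s hs).congr_of_eventuallyEq ?_
  filter_upwards [eventually_lt_re hs] with z hz using h.logBranch_eq ha hz

theorem IsRealLog.hasDerivAt_logDeriv {f L L' L'' : ℂ → ℂ} {a : ℝ} (h : IsRealLog f L L' L'' a)
    {s : ℂ} (hs : a < s.re) : HasDerivAt (logDeriv f) (deriv (logDeriv f) s) s := by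
  rw [h.deriv_logDeriv_eq hs]
  refine (h.hasDerivAt' s hs).congr_of_eventuallyEq ?_
  filter_upwards [eventually_lt_re hs] with z hz using h.logDeriv_eq hz

/-- The branches of the logarithms inherit a multiplicative ladder relation. -/
theorem logBranch_add {E F : ℂ → ℂ} {l : ℕ} (hl : 1 ≤ l) (hE : HasRealLog E 0)
    (hF : HasRealLog F (-l)) (h : ∀ s : ℂ, -(l : ℝ) < s.re → F (s + l) = F s * E (s + l))
    {s : ℂ} (hs : -(l : ℝ) < s.re) :
    logBranch F (s + l) = logBranch F s + logBranch E (s + l) := by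
  obtain ⟨L, L', L'', hL, -⟩ := hE
  obtain ⟨M, M', M'', hM, -⟩ := hF
  have hl0 : (1 : ℝ) ≤ l := by exact_mod_cast hl
  have h1 := hM.comp_affine (b := -l) l 1 one_pos (by linarith)
  have h2 := hL.comp_affine (b := -l) l 1 one_pos (by linarith)
  have h3 := h1.congr (g := fun s => F s * E ((s + (l : ℝ)) / (1 : ℝ))) fun s hs => by
    simpa using h s hs
  -- Both sides are real logarithms of `z ↦ F (z + l)` on `Re z > -l`, a half plane containing the
  -- base point 1.
  have h4 := h3.unique (hM.mul h2) (by linarith) hs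
  have hs' : 0 < (s + l).re := by simp; linarith
  rw [hM.logBranch_eq (by linarith) (hs.trans (by simp; linarith)), hM.logBranch_eq (by linarith) hs,
    hL.logBranch_eq one_pos hs']
  simpa using h4

theorem E2_eq (s : ℂ) :
    E2 s = (Complex.Gamma (s / (2 : ℝ)))⁻¹ * Complex.Gamma ((s + (1 : ℝ)) / (2 : ℝ)) := by
  simp [E2]

theorem E3_eq (s : ℂ) :
    E3 s = (Complex.Gamma (s / (3 : ℝ)))⁻¹ * Complex.Gamma ((s + (2 : ℝ)) / (3 : ℝ)) := by
  simp [E3]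

theorem XiEll_eq (Γ : Subgroup (Matrix.SpecialLinearGroup (Fin 2) ℤ)) (s : ℂ) :
    XiEll Γ s = Complex.exp ((ellipticNumber Γ 2 : ℂ) / 2 * logBranch E2 s
      + 2 * (ellipticNumber Γ 3 : ℂ) / 3 * logBranch E3 s) := by
  rw [XiEll, Complex.exp_add]

theorem logDeriv_XiEll_comp_add (Γ : Subgroup (Matrix.SpecialLinearGroup (Fin 2) ℤ)) {c s : ℂ}
    (hs : 0 < (s + c).re) :
    logDeriv (fun z => XiEll Γ (z + c)) s = (ellipticNumber Γ 2 : ℂ) / 2 * logDeriv E2 (s + c)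
      + 2 * (ellipticNumber Γ 3 : ℂ) / 3 * logDeriv E3 (s + c) := by
  obtain ⟨L, L', L'', hL, -⟩ := hasRealLog_E2
  obtain ⟨M, M', M'', hM, -⟩ := hasRealLog_E3
  simp only [XiEll_eq]
  exact logDeriv_cexp ((((hL.hasDerivAt_logBranch one_pos hs).comp_add_const s c).const_mul _).add
    (((hM.hasDerivAt_logBranch one_pos hs).comp_add_const s c).const_mul _))

theorem deriv_logDeriv_XiHigherEll (Γ : Subgroup (Matrix.SpecialLinearGroup (Fin 2) ℤ)) {l : ℕ}
    (hl : 1 ≤ l) {s : ℂ} (hs : -(l : ℝ) < s.re) :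
    deriv (logDeriv (XiHigherEll Γ l)) s =
      (ellipticNumber Γ 2 : ℂ) / 2 * deriv (logDeriv (G l)) s
        + 2 * (ellipticNumber Γ 3 : ℂ) / 3 * deriv (logDeriv (H l)) s := by
  obtain ⟨L, L', L'', hL, -⟩ := hasRealLog_G hl
  obtain ⟨M, M', M'', hM, -⟩ := hasRealLog_H hl
  have hl1 : -(l : ℝ) < 1 := by
    have : (0 : ℝ) ≤ l := l.cast_nonneg
    linarith
  refine ((((hL.hasDerivAt_logDeriv hs).const_mul ((ellipticNumber Γ 2 : ℂ) / 2)).add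
    ((hM.hasDerivAt_logDeriv hs).const_mul
      (2 * (ellipticNumber Γ 3 : ℂ) / 3))).congr_of_eventuallyEq ?_).deriv
  filter_upwards [eventually_lt_re hs] with z hz
  exact logDeriv_cexp (((hL.hasDerivAt_logBranch hl1 hz).const_mul _).add
    ((hM.hasDerivAt_logBranch hl1 hz).const_mul _))

end HigherSelberg

end

open HigherSelberg

/-! ### Assembly of the two elliptic orders. -/

theorem proposition3p4p3 (N l : ℕ) (hN : 1 ≤ N) (hl : 1 ≤ l)
    (Γ : Subgroup (Matrix.SpecialLinearGroup (Fin 2) ℤ))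
    (hΓ : Γ = CongruenceSubgroup.Gamma0 N ∨ Γ = CongruenceSubgroup.Gamma1 N ∨
      Γ = CongruenceSubgroup.Gamma N) :
    -- the logarithms that define the two factors are holomorphic logarithms
    (HigherSelberg.IsHolLogOn (HigherSelberg.logBranch (HigherSelberg.G l))
        (HigherSelberg.G l) (-l) ∧
      HigherSelberg.IsHolLogOn (HigherSelberg.logBranch (HigherSelberg.H l))
        (HigherSelberg.H l) (-l) ∧
      HigherSelberg.IsHolLogOn (HigherSelberg.logBranch HigherSelberg.E2) HigherSelberg.E2 0 ∧
      HigherSelberg.IsHolLogOn (HigherSelberg.logBranch HigherSelberg.E3) HigherSelberg.E3 0) ∧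
    -- the elliptic terms of the trace formula
    (∀ s : ℂ, (1 - (l : ℝ)) / 2 < s.re →
      (∀ r : ℝ, Summable (HigherSelberg.phiTerm l s r)) ∧
      MeasureTheory.Integrable
        (fun r : ℝ => HigherSelberg.testFun l s r * (HigherSelberg.kernel2 r : ℂ)) ∧
      MeasureTheory.Integrable
        (fun r : ℝ => HigherSelberg.testFun l s r * (HigherSelberg.kernel3 r : ℂ)) ∧
      HigherSelberg.ellipticTerms Γ (HigherSelberg.testFun l s) =
        deriv (logDeriv (HigherSelberg.XiHigherEll Γ l)) s
          - 1 / (l : ℂ) * logDeriv (fun z : ℂ => HigherSelberg.XiEll Γ (z + (l : ℂ) / 2)) s) ∧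
    -- the ladder relation
    (∀ s : ℂ, 1 - (l : ℝ) < s.re →
      HigherSelberg.XiHigherEll Γ l s =
        HigherSelberg.XiHigherEll Γ l (s + l) / HigherSelberg.XiEll Γ (s + l)) := by
  have hl0 : (1 : ℝ) ≤ l := by exact_mod_cast hl
  have hl1 : -(l : ℝ) < 1 := by linarith
  have hG := hasRealLog_G hl
  have hH := hasRealLog_H hl
  have hE2 := hasRealLog_E2
  have hE3 := hasRealLog_E3
  refine ⟨⟨?_, ?_, ?_, ?_⟩, fun s hs => ⟨fun r => summable_phiTerm hl hs r, ?_⟩, fun s hs => ?_⟩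
  · obtain ⟨L, L', L'', hL, -⟩ := hG
    exact hL.isHolLogOn hl1
  · obtain ⟨L, L', L'', hL, -⟩ := hH
    exact hL.isHolLogOn hl1
  · obtain ⟨L, L', L'', hL, -⟩ := hE2
    exact hL.isHolLogOn one_pos
  · obtain ⟨L, L', L'', hL, -⟩ := hE3
    exact hL.isHolLogOn one_pos
  · obtain ⟨i2, v2⟩ := isEllipticKernel_kernel2.integral_testFun zero_le_one two_pos hl hE2 hG
      (fun s _ => E2_eq s) (fun s hs => G_add hl hs) hs
    obtain ⟨i3, v3⟩ := isEllipticKernel_kernel3.integral_testFun zero_le_two three_pos hl hE3 hH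
      (fun s _ => E3_eq s) (fun s hs => H_add hl hs) hs
    refine ⟨i2, i3, ?_⟩
    have hre : 0 < (s + (l : ℂ) / 2).re := by
      simp
      linarith
    have h3 : (Real.sqrt 3 : ℂ) ≠ 0 :=
      Complex.ofReal_ne_zero.mpr (Real.sqrt_ne_zero'.mpr three_pos)
    -- The factor `2C` converts `ν₂ / 4` into `ν₂ / 2` (`C = 1`) and `ν₃ / (3√3)` into `2ν₃ / 3` (`C
    -- = √3`), the exponents in both gamma factors.
    rw [ellipticTerms, v2, v3, deriv_logDeriv_XiHigherEll Γ hl (by linarith),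
      logDeriv_XiEll_comp_add Γ hre, Complex.ofReal_one]
    field_simp
    ring
  · have hs' : -(l : ℝ) < s.re := by linarith
    rw [eq_div_iff (by rw [XiEll_eq]; exact Complex.exp_ne_zero _), XiEll_eq, XiHigherEll,
      XiHigherEll, ← Complex.exp_add, logBranch_add hl hE2 hG (fun s hs => G_add hl hs) hs',
      logBranch_add hl hE3 hH (fun s hs => H_add hl hs) hs']
    congr 1
    ring
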